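/- Let $k$ be a field of arbitrary characteristic, let $m\ge 6$ and $n=3m+2$, and let $S=k[a_i,b_i,c_i,d,e]_{i=1}^m$ be the polynomial ring in $n$ variables, where the indices $i$ are read modulo $m$. Let $P\subset \operatorname{Hom}_k(S,k)$ be the space of functionals that vanish on all sufficiently high powers of the ideal $S_+$ generated by the variables, with the contraction action $(s\cdot f)(t)=f(st)$ of $S$; for a monomial $\mathbf{x}$ of $S$ let $\mathbf{x}^{\vee}\in P$ be the functional with value $1$ on $\mathbf{x}$ and $0$ on every other monomial. For $f\in P$ put $\operatorname{Ann}(f)=\{s\in S: s\cdot f=0\}$ and $\operatorname{Apolar}(f)=S/\operatorname{Ann}(f)$. Consider the cubic $$F''=\sum_{i=1}^m \bigl(a_ib_ic_i + a_ia_{i+1}^2 + b_ib_{i+1}^2 + c_ic_{i+1}^2 + a_ib_{i+1}d + b_ic_{i+1}e\bigr),$$ and denote also by $F''$ its dual element in $P$, the image of $F''$ under the $k$-linear map $\mathbf{x}\mapsto \mathbf{x}^{\vee}$; it is homogeneous of degree $3$ (a linear combination of the $\mathbf{x}^{\vee}$ with $\deg\mathbf{x}=3$). Then $\operatorname{Apolar}(F'')$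 satisfies the small tangent space condition, that is, with $I=\operatorname{Ann}(F'')$ and $H(M)_i=\dim_k M_i$ for a graded module $M$: 1. $\operatorname{Apolar}(F'')=S/I$ has Hilbert function $(1,n,n,1)$, i.e. $H(S/I)_0=H(S/I)_3=1$, $H(S/I)_1=H(S/I)_2=n$, and $H(S/I)_i=0$ for $i\ge 4$; 2. $H(S/I^2)_4=n$ and $H(S/I^2)_5=0$. -/

import Mathlib

namespace Apolarity

open MvPolynomial

noncomputable section

variable (σ k : Type*) [Field k]

/-- The divided power module `P ⊆ S^∨ = Hom_k(S, k)` of the polynomial ring `S = k[σ]`: all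
functionals that vanish on every sufficiently high power of `S_+ = (α_i)_i`. -/
def DividedPower : Submodule k (Module.Dual k (MvPolynomial σ k)) where
  carrier := {f | ∃ N₀ : ℕ, ∀ N ≥ N₀, ∀ s ∈ idealOfVars σ k ^ N, f s = 0}
  zero_mem' := ⟨0, fun _ _ _ _ => rfl⟩
  add_mem' := by
    rintro f g ⟨N, hN⟩ ⟨M, hM⟩
    refine ⟨max N M, fun K hK s hs => ?_⟩
    simp [hN K (le_trans (le_max_left _ _) hK) s hs, hM K (le_trans (le_max_right _ _) hK) s hs]
  smul_mem' := by
    rintro c f ⟨N, hN⟩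
    refine ⟨N, fun K hK s hs => ?_⟩
    simp [hN K hK s hs]

variable {σ k}

/-- Contraction: the action of `s ∈ S` on `P` induced from `S^∨`, `(s · f)(t) = f (s t)`. -/
def contract (s : MvPolynomial σ k) (f : DividedPower σ k) : DividedPower σ k :=
  ⟨f.1 ∘ₗ LinearMap.mulLeft k s, by
    obtain ⟨N, hN⟩ := f.2
    exact ⟨N, fun K hK t ht => hN K hK (s * t) (Ideal.mul_mem_left _ s ht)⟩⟩

@[simp] theorem contract_apply (s t : MvPolynomial σ k) (f : DividedPower σ k) :
    (contract s f).1 t = f.1 (s * t) := rfl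

/-- The annihilator `Ann(f) = {s ∈ S : s · f = 0}`. -/
def Ann (f : DividedPower σ k) : Ideal (MvPolynomial σ k) where
  carrier := {s | contract s f = 0}
  zero_mem' := by
    apply Subtype.ext
    apply LinearMap.ext
    intro t
    simp
  add_mem' := by
    intro s s' hs hs'
    apply Subtype.ext
    apply LinearMap.ext
    intro t
    have h1 := congrArg (fun g : DividedPower σ k => g.1 t) hs
    have h2 := congrArg (fun g : DividedPower σ k => g.1 t) hs'
    simp only [contract_apply, ZeroMemClass.coe_zero, LinearMap.zero_apply] at h1 h2
    simp [add_mul, h1, h2]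
  smul_mem' := by
    intro r s hs
    apply Subtype.ext
    apply LinearMap.ext
    intro t
    have h1 := congrArg (fun g : DividedPower σ k => g.1 (r * t)) hs
    simp only [contract_apply, ZeroMemClass.coe_zero, LinearMap.zero_apply] at h1
    simp only [contract_apply, smul_eq_mul, ZeroMemClass.coe_zero, LinearMap.zero_apply]
    rw [← h1]
    congr 1
    ring

theorem mem_Ann {f : DividedPower σ k} {s : MvPolynomial σ k} :
    s ∈ Ann f ↔ contract s f = 0 := Iff.rfl

/-- The basis element `x^{[a]}` of `P`: the functional dual to the monomial `α^a`. -/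
def dualMonomial (a : σ →₀ ℕ) : DividedPower σ k :=
  ⟨lcoeff k a, a.degree + 1, fun N hN s hs => by
    have h := (mem_pow_idealOfVars_iff' N s).1 hs a (by omega)
    simpa using h⟩

theorem dualMonomial_monomial [DecidableEq σ] (a b : σ →₀ ℕ) :
    (dualMonomial a : DividedPower σ k).1 (monomial b 1) = if a = b then 1 else 0 := by
  simp [dualMonomial, coeff_monomial, eq_comm]

/-- `f ∈ P` is homogeneous of degree `d`. -/
def IsHomogeneousOfDegree (f : DividedPower σ k) (d : ℕ) : Prop :=
  f ∈ Submodule.span k {g : DividedPower σ k | ∃ a : σ →₀ ℕ, a.degree = d ∧ g = dualMonomial a}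

/-- The dual element in `P` of a polynomial: the `k`-linear extension of `α^a ↦ x^{[a]}`. -/
def dualElement : MvPolynomial σ k →ₗ[k] DividedPower σ k :=
  (basisMonomials σ k).constr k dualMonomial

/-- `H(S/J)_i`, for a homogeneous ideal `J`: the dimension over `k` of the degree `i` component
of `S/J`, that is, of the image of `S_i` in `S/J`. -/
def hilbertFunction (J : Ideal (MvPolynomial σ k)) (i : ℕ) : ℕ :=
  Module.finrank k
    ((homogeneousSubmodule σ k i).map (Ideal.Quotient.mkₐ k J).toLinearMap)

/-- The apolar algebra of a cubic `f ∈ P` satisfies the small tangent space condition; here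
`n = Nat.card σ` is the (finite) number of variables, `Apolar(f) = S/Ann(f)`. -/
structure SmallTangentSpaceCondition [Finite σ] (f : DividedPower σ k) : Prop where
  homogeneous : IsHomogeneousOfDegree f 3
  hilbert_zero : hilbertFunction (Ann f) 0 = 1
  hilbert_one : hilbertFunction (Ann f) 1 = Nat.card σ
  hilbert_two : hilbertFunction (Ann f) 2 = Nat.card σ
  hilbert_three : hilbertFunction (Ann f) 3 = 1
  hilbert_ge_four : ∀ i, 4 ≤ i → hilbertFunction (Ann f) i = 0
  hilbert_sq_four : hilbertFunction (Ann f ^ 2) 4 = Nat.card σ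
  hilbert_sq_five : hilbertFunction (Ann f ^ 2) 5 = 0

/-- The index set of the variables `a_i, b_i, c_i` (`i` modulo `m`), `d`, `e`. -/
abbrev Var (m : ℕ) : Type := (Fin 3 × ZMod m) ⊕ Fin 2

theorem card_Var (m : ℕ) [NeZero m] : Nat.card (Var m) = 3 * m + 2 := by
  simp [Var]

variable (k) {m : ℕ}

/-- The variable `a_i`. -/
def a (i : ZMod m) : MvPolynomial (Var m) k := X (Sum.inl (0, i))
/-- The variable `b_i`. -/
def b (i : ZMod m) : MvPolynomial (Var m) k := X (Sum.inl (1, i))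
/-- The variable `c_i`. -/
def c (i : ZMod m) : MvPolynomial (Var m) k := X (Sum.inl (2, i))
/-- The variable `d`. -/
def d : MvPolynomial (Var m) k := X (Sum.inr 0)
/-- The variable `e`. -/
def e : MvPolynomial (Var m) k := X (Sum.inr 1)

variable (m)

/-- The cubic polynomial `F` in the variables `a_i, b_i, c_i`. -/
def cubicF [NeZero m] : MvPolynomial (Var m) k :=
  ∑ i : ZMod m, (a k i * b k i * c k i + a k i * a k (i + 1) ^ 2
    + b k i * b k (i + 1) ^ 2 + c k i * c k (i + 1) ^ 2)

/-- The cubic polynomial `F''`. -/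
def cubicF'' [NeZero m] : MvPolynomial (Var m) k :=
  cubicF k m + ∑ i : ZMod m, (a k i * b k (i + 1) * d k + b k i * c k (i + 1) * e k)

end

end Apolarity

namespace Apolarity

open MvPolynomial

/-! Write `I` for the annihilator and call two variables related if their product divides a term of
the cubic. The cubic is a sum of distinct monomials with coefficient 1, and two related variables
`x`, `y` lie in exactly one term `x y z`; `compl` records `z`. Contraction introduces no factorials,
so in every characteristic `x y` sends the cubic to the dual of `z`, or to 0. Hence `I` contains the
products of unrelated variables, the differences of products with the same complement, the cubic
monomials that are not terms, and everything of degree at least 4. This gives the Hilbert function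
`(1, n, n, 1)`, with the variables and chosen complementary pairs as dual bases.

For degree 4 of `S/I^2`, the lower bound comes from the functionals `s ↦ φ (∂s/∂x)`, which kill
`I^2` by the Leibniz rule (`phiDeriv_eq_zero`). They are dual to quartics `eps y = y · (term)`,
where the term has a factor unrelated to `y` (`phiDeriv_eps`). For the upper bound, `y · (term)`
does not depend on the term modulo `I^2`: two terms can be compared when suitable factors lie in a
common term, and the resulting graph is connected (`star_sub_base_mem`). Every other quartic
monomial is reduced to these by multiplying two of the quadrics above (`quad_mem_reach`). Relations
only involve neighbouring indices, so finitely many local configurations occur, uniformly in `m`.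
They are settled by a kernel-evaluated search on symbolic indices, proved sound for every `m ≥ 6`.

For degree 5, `v · eps y` can be rewritten as `(v p)(q r y)` with a term `p q r` far from `v` and
`y`, and both factors lie in `I` (`vr_mul_eps_mem`). -/

/-- The variables `a_i, b_i, c_i, d, e`, for indices `i` in any type. -/
inductive Vr (A : Type*) where
  | a (i : A) : Vr A
  | b (i : A) : Vr A
  | c (i : A) : Vr A
  | d : Vr A
  | e : Vr A
  deriving DecidableEq

/-- Relabelling of the indices. -/
def Vr.map {A B : Type*} (f : A → B) : Vr A → Vr B
  | .a i => .a (f i)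
  | .b i => .b (f i)
  | .c i => .c (f i)
  | .d => .d
  | .e => .e

/-- The variables, as the index set of the polynomial ring. -/
def equivVar (m : ℕ) : Vr (ZMod m) ≃ Var m where
  toFun
    | .a i => Sum.inl (0, i)
    | .b i => Sum.inl (1, i)
    | .c i => Sum.inl (2, i)
    | .d => Sum.inr 0
    | .e => Sum.inr 1
  invFun
    | Sum.inl (0, i) => .a i
    | Sum.inl (1, i) => .b i
    | Sum.inl (2, i) => .c i
    | Sum.inr 0 => .d
    | Sum.inr 1 => .e
  left_inv x := by cases x <;> rfl
  right_inv x := by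
    rcases x with ⟨r, i⟩ | r <;> fin_cases r <;> rfl

/-! ### Combinatorics of the terms of the cubic. -/

/-- The variable `z` such that `x y z` is a term of the cubic `F''`, if there is one. -/
def compl {m : ℕ} : Vr (ZMod m) → Vr (ZMod m) → Option (Vr (ZMod m))
  | .a i, .a j => if j = i + 1 then some (.a j) else if i = j + 1 then some (.a i)
      else if i = j then some (.a (i - 1)) else none
  | .b i, .b j => if j = i + 1 then some (.b j) else if i = j + 1 then some (.b i)
      else if i = j then some (.b (i - 1)) else none
  | .c i, .c j => if j = i + 1 then some (.c j) else if i = j + 1 then some (.c i)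
      else if i = j then some (.c (i - 1)) else none
  | .a i, .b j => if i = j then some (.c i) else if j = i + 1 then some .d else none
  | .b j, .a i => if i = j then some (.c i) else if j = i + 1 then some .d else none
  | .a i, .c j => if i = j then some (.b i) else none
  | .c j, .a i => if i = j then some (.b i) else none
  | .b i, .c j => if i = j then some (.a i) else if j = i + 1 then some .e else none
  | .c j, .b i => if i = j then some (.a i) else if j = i + 1 then some .e else none
  | .a i, .d => some (.b (i + 1))
  | .d, .a i => some (.b (i + 1))
  | .b i, .d => some (.a (i - 1))
  | .d, .b i => some (.a (i - 1))
  | .b i, .e => some (.c (i + 1))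
  | .e, .b i => some (.c (i + 1))
  | .c i, .e => some (.b (i - 1))
  | .e, .c i => some (.b (i - 1))
  | .a _, .e => none
  | .e, .a _ => none
  | .c _, .d => none
  | .d, .c _ => none
  | .d, .d => none
  | .d, .e => none
  | .e, .d => none
  | .e, .e => none

theorem compl_comm {m : ℕ} (hm : 6 ≤ m) (x y : Vr (ZMod m)) : compl x y = compl y x := by
  -- If `2 = 0`, the cases `j = i + 1` and `i = j + 1` would overlap and the order of the tests
  -- would break the symmetry.
  have h2 : (2 : ZMod m) ≠ 0 := by
    intro h
    have := (ZMod.natCast_eq_zero_iff 2 m).1 (by exact_mod_cast h)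
    exact absurd (Nat.le_of_dvd (by norm_num) this) (by omega)
  cases x <;> cases y <;> simp only [compl] <;> split_ifs <;> first | rfl | grind

/-- The `r`-th of the six kinds of terms of the cubic. -/
def term {m : ℕ} (i : ZMod m) : Fin 6 → Vr (ZMod m) × Vr (ZMod m) × Vr (ZMod m)
  | 0 => (.a i, .b i, .c i)
  | 1 => (.a i, .a (i + 1), .a (i + 1))
  | 2 => (.b i, .b (i + 1), .b (i + 1))
  | 3 => (.c i, .c (i + 1), .c (i + 1))
  | 4 => (.a i, .b (i + 1), .d)
  | 5 => (.b i, .c (i + 1), .e)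

/-- Two triples agree up to order. -/
def SameTriple {α : Type*} (t u : α × α × α) : Prop :=
  (t.1 = u.1 ∧ t.2.1 = u.2.1 ∧ t.2.2 = u.2.2) ∨ (t.1 = u.1 ∧ t.2.1 = u.2.2 ∧ t.2.2 = u.2.1) ∨
  (t.1 = u.2.1 ∧ t.2.1 = u.1 ∧ t.2.2 = u.2.2) ∨ (t.1 = u.2.1 ∧ t.2.1 = u.2.2 ∧ t.2.2 = u.1) ∨
  (t.1 = u.2.2 ∧ t.2.1 = u.1 ∧ t.2.2 = u.2.1) ∨ (t.1 = u.2.2 ∧ t.2.1 = u.2.1 ∧ t.2.2 = u.1)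

/-- The six-fold disjunction suits case analysis on variables; the multiset form gives symmetry and
transitivity and matches exponent vectors. -/
theorem sameTriple_iff {α : Type*} [DecidableEq α] (t u : α × α × α) :
    SameTriple t u ↔
      ({t.1, t.2.1, t.2.2} : Multiset α) = {u.1, u.2.1, u.2.2} := by
  obtain ⟨x, y, z⟩ := t
  obtain ⟨p, q, r⟩ := u
  simp only [SameTriple, Multiset.insert_eq_cons]
  constructor
  · rintro (⟨rfl, rfl, rfl⟩ | ⟨rfl, rfl, rfl⟩ | ⟨rfl, rfl, rfl⟩ | ⟨rfl, rfl, rfl⟩ |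
      ⟨rfl, rfl, rfl⟩ | ⟨rfl, rfl, rfl⟩) <;> ext w <;>
      simp only [Multiset.count_cons, Multiset.count_singleton] <;> omega
  · intro h
    have two : ∀ y z q r : α, ({y, z} : Multiset α) = {q, r} →
        (y = q ∧ z = r) ∨ (y = r ∧ z = q) := by
      intro y z q r h
      rw [Multiset.insert_eq_cons, Multiset.insert_eq_cons, Multiset.cons_eq_cons] at h
      rcases h with ⟨h1, h2⟩ | ⟨_, cs, h2, h3⟩
      · exact Or.inl ⟨h1, by simpa using h2⟩
      · have hc : cs = 0 := by
          have := congrArg Multiset.card h2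
          simpa using this
        subst hc
        simp only [Multiset.cons_zero, Multiset.singleton_inj] at h2 h3
        exact Or.inr ⟨h3.symm, h2⟩
    have hx : x ∈ (p ::ₘ q ::ₘ {r} : Multiset α) := by rw [← h]; simp
    simp only [Multiset.mem_cons, Multiset.mem_singleton] at hx
    rcases hx with rfl | rfl | rfl
    · have := two y z q r (by simpa using h)
      tauto
    · have := two y z p r (by
        rw [Multiset.cons_swap p x] at h; simpa using h)
      tauto
    · have := two y z p q (by
        have e : (p ::ₘ q ::ₘ {x} : Multiset α) = x ::ₘ p ::ₘ {q} := by
          ext w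
          simp only [Multiset.count_cons, Multiset.count_singleton]
          omega
        rw [e] at h; simpa using h)
      tauto

/-- Two factors of a term determine the third, because no two terms share a pair of factors. In
`ZMod m` this needs `1` and `2` to be nonzero. -/
theorem compl_of_sameTriple {m : ℕ} (hm : 6 ≤ m) {x y z : Vr (ZMod m)} {i : ZMod m} {r : Fin 6}
    (h : SameTriple (x, y, z) (term i r)) : compl x y = some z := by
  have h1 : (1 : ZMod m) ≠ 0 := by
    have : Fact (1 < m) := ⟨by omega⟩
    exact one_ne_zero
  have h2 : (2 : ZMod m) ≠ 0 := by
    intro h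
    have := (ZMod.natCast_eq_zero_iff 2 m).1 (by exact_mod_cast h)
    exact absurd (Nat.le_of_dvd (by norm_num) this) (by omega)
  have h2' : ¬ i = i + 1 + 1 := fun h => h2 (by linear_combination -h)
  fin_cases r <;> simp only [SameTriple, term] at h <;>
    rcases h with ⟨rfl, rfl, rfl⟩ | ⟨rfl, rfl, rfl⟩ | ⟨rfl, rfl, rfl⟩ | ⟨rfl, rfl, rfl⟩ |
      ⟨rfl, rfl, rfl⟩ | ⟨rfl, rfl, rfl⟩ <;> simp [compl, h1, h2']

theorem exists_term_of_compl {m : ℕ} {x y z : Vr (ZMod m)} (h : compl x y = some z) :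
    ∃ i r, SameTriple (x, y, z) (term i r) := by
  have key : ∀ i r, SameTriple (x, y, z) (term i r) →
    ∃ i r, SameTriple (x, y, z) (term i r) := fun i r h => ⟨i, r, h⟩
  cases x with
  | a i =>
    cases y <;> simp only [compl] at h <;> (try split_ifs at h) <;>
      simp only [Option.some.injEq, reduceCtorEq] at h <;> subst h <;>
      first
      | (refine key i 0 ?_; clear key; simp_all [SameTriple, term]; done)
      | (refine key i 1 ?_; clear key; simp_all [SameTriple, term]; done)
      | (refine key (i - 1) 1 ?_; clear key; simp_all [SameTriple, term]; done)
      | (refine key i 4 ?_; clear key; simp_all [SameTriple, term]; done)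
  | b i =>
    cases y <;> simp only [compl] at h <;> (try split_ifs at h) <;>
      simp only [Option.some.injEq, reduceCtorEq] at h <;> subst h <;>
      first
      | (refine key i 0 ?_; clear key; simp_all [SameTriple, term]; done)
      | (refine key i 2 ?_; clear key; simp_all [SameTriple, term]; done)
      | (refine key (i - 1) 2 ?_; clear key; simp_all [SameTriple, term]; done)
      | (refine key (i - 1) 4 ?_; clear key; simp_all [SameTriple, term]; done)
      | (refine key i 5 ?_; clear key; simp_all [SameTriple, term]; done)
  | c i =>
    cases y <;> simp only [compl] at h <;> (try split_ifs at h) <;>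
      simp only [Option.some.injEq, reduceCtorEq] at h <;> subst h <;>
      first
      | (refine key i 0 ?_; clear key; simp_all [SameTriple, term]; done)
      | (refine key i 3 ?_; clear key; simp_all [SameTriple, term]; done)
      | (refine key (i - 1) 3 ?_; clear key; simp_all [SameTriple, term]; done)
      | (refine key (i - 1) 5 ?_; clear key; simp_all [SameTriple, term]; done)
  | d =>
    cases y <;> simp only [compl] at h <;>
      simp only [Option.some.injEq, reduceCtorEq] at h <;> subst h
    · rename_i i
      exact key i 4 (by simp [SameTriple, term])
    · rename_i i
      exact key (i - 1) 4 (by simp [SameTriple, term])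
  | e =>
    cases y <;> simp only [compl] at h <;>
      simp only [Option.some.injEq, reduceCtorEq] at h <;> subst h
    · rename_i i
      exact key i 5 (by simp [SameTriple, term])
    · rename_i i
      exact key (i - 1) 5 (by simp [SameTriple, term])

/-- No monomial is listed twice, so every coefficient of the cubic is 1 and cannot vanish in small
characteristic. -/
theorem term_injective {m : ℕ} {i j : ZMod m} {r s : Fin 6}
    (h : SameTriple (term i r) (term j s)) : i = j ∧ r = s := by
  fin_cases r <;> fin_cases s <;> simp [SameTriple, term] at h ⊢ <;> tauto

theorem compl_rotate {m : ℕ} (hm : 6 ≤ m) {x y z : Vr (ZMod m)} (h : compl x y = some z) :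
    compl y z = some x := by
  obtain ⟨i, r, h⟩ := exists_term_of_compl h
  refine compl_of_sameTriple hm (i := i) (r := r) ?_
  simp only [SameTriple] at h ⊢
  tauto

theorem compl_swap {m : ℕ} (hm : 6 ≤ m) {x y z : Vr (ZMod m)} (h : compl x y = some z) :
    compl x z = some y := by
  obtain ⟨i, r, h⟩ := exists_term_of_compl h
  refine compl_of_sameTriple hm (i := i) (r := r) ?_
  simp only [SameTriple] at h ⊢
  tauto

/-! ### The functional of the cubic and elements of its annihilator. -/

noncomputable section

variable (k : Type*) [Field k] {m : ℕ}

/-- A variable as an element of the polynomial ring. -/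
def vr (x : Vr (ZMod m)) : MvPolynomial (Var m) k := X (equivVar m x)

variable (m) in
/-- The functional defined by the cubic `F''`. -/
def phi [NeZero m] : Module.Dual k (MvPolynomial (Var m) k) := (dualElement (cubicF'' k m)).1

variable {k}

theorem dualElement_monomial {σ : Type*} (s : σ →₀ ℕ) :
    dualElement (monomial s (1 : k)) = dualMonomial s := by
  have := (basisMonomials σ k).constr_basis k (dualMonomial (k := k)) s
  simpa [dualElement, coe_basisMonomials] using this

/-- The exponent of `x y z`. -/
def expo (t : Vr (ZMod m) × Vr (ZMod m) × Vr (ZMod m)) : Var m →₀ ℕ :=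
  Finsupp.single (equivVar m t.1) 1 + Finsupp.single (equivVar m t.2.1) 1
    + Finsupp.single (equivVar m t.2.2) 1

theorem degree_expo (t : Vr (ZMod m) × Vr (ZMod m) × Vr (ZMod m)) : (expo t).degree = 3 := by
  simp [expo]

theorem monomial_expo (x y z : Vr (ZMod m)) :
    vr k x * vr k y * vr k z = monomial (expo (x, y, z)) 1 := by
  simp [vr, expo, X, monomial_mul]

theorem expo_inj (t u : Vr (ZMod m) × Vr (ZMod m) × Vr (ZMod m)) :
    expo t = expo u ↔ SameTriple t u := by
  have h : ∀ t : Vr (ZMod m) × Vr (ZMod m) × Vr (ZMod m),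
      expo t = Multiset.toFinsupp
        (Multiset.map (equivVar m) ({t.1, t.2.1, t.2.2} : Multiset (Vr (ZMod m)))) := by
    intro t
    simp only [expo, Multiset.insert_eq_cons, ← Multiset.singleton_add, Multiset.map_add,
      Multiset.map_singleton, map_add, Multiset.toFinsupp_singleton, add_assoc]
  rw [sameTriple_iff, h, h, EmbeddingLike.apply_eq_iff_eq,
    (Multiset.map_injective (equivVar m).injective).eq_iff]

theorem cubicF''_eq [NeZero m] :
    cubicF'' k m = ∑ p : ZMod m × Fin 6, monomial (expo (term p.1 p.2)) 1 := by
  rw [Fintype.sum_prod_type, cubicF'', cubicF, ← Finset.sum_add_distrib]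
  refine Finset.sum_congr rfl fun i _ => ?_
  simp only [Fin.sum_univ_six, term, ← monomial_expo]
  simp only [vr, equivVar, Equiv.coe_fn_mk, Apolarity.a, Apolarity.b, Apolarity.c, Apolarity.d,
    Apolarity.e]
  ring

theorem dualElement_cubicF'' [NeZero m] :
    dualElement (cubicF'' k m)
      = ∑ p : ZMod m × Fin 6, dualMonomial (expo (term p.1 p.2)) := by
  rw [cubicF''_eq, map_sum]
  simp only [dualElement_monomial]

theorem phi_apply [NeZero m] (s : MvPolynomial (Var m) k) :
    phi k m s = ∑ p : ZMod m × Fin 6, coeff (expo (term p.1 p.2)) s := by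
  rw [phi, dualElement_cubicF'']
  simp [dualMonomial]

theorem phi_triple [NeZero m] (hm : 6 ≤ m) (x y z : Vr (ZMod m)) :
    phi k m (vr k x * vr k y * vr k z) = if compl x y = some z then 1 else 0 := by
  classical
  rw [phi_apply, monomial_expo]
  simp only [coeff_monomial, expo_inj]
  split_ifs with h
  · obtain ⟨i, r, h⟩ := exists_term_of_compl h
    rw [Finset.sum_eq_single (i, r)]
    · simp [h]
    · rintro ⟨j, s⟩ - hne
      rw [if_neg]
      intro h'
      refine hne ?_
      have : SameTriple (term j s) (term i r) := by
        rw [sameTriple_iff] at h h' ⊢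
        rw [← h', h]
      obtain ⟨rfl, rfl⟩ := term_injective this
      rfl
    · simp
  · refine Finset.sum_eq_zero fun p _ => if_neg fun h' => h ?_
    exact compl_of_sameTriple hm h'

theorem phi_of_isHomogeneous [NeZero m] {s : MvPolynomial (Var m) k} {n : ℕ}
    (hs : s.IsHomogeneous n) (hn : n ≠ 3) : phi k m s = 0 := by
  rw [phi_apply]
  refine Finset.sum_eq_zero fun p _ => ?_
  exact hs.coeff_eq_zero (by rw [degree_expo]; exact hn.symm)

theorem isHomogeneousOfDegree_cubicF'' [NeZero m] :
    IsHomogeneousOfDegree (dualElement (cubicF'' k m)) 3 := by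
  rw [dualElement_cubicF'']
  exact Submodule.sum_mem _ fun p _ => Submodule.subset_span ⟨_, degree_expo _, rfl⟩

theorem mem_Ann_iff [NeZero m] {s : MvPolynomial (Var m) k} :
    s ∈ Ann (dualElement (cubicF'' k m)) ↔ ∀ t, phi k m (s * t) = 0 := by
  rw [mem_Ann, Subtype.ext_iff, LinearMap.ext_iff]
  rfl

theorem vr_isHomogeneous (x : Vr (ZMod m)) : (vr k x).IsHomogeneous 1 := isHomogeneous_X _ _

/-- Membership in the annihilator can be tested on monomials of complementary degree. -/
theorem mem_Ann_of_isHomogeneous [NeZero m] {s : MvPolynomial (Var m) k} {n : ℕ}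
    (hs : s.IsHomogeneous n)
    (h : ∀ u : Var m →₀ ℕ, n + u.degree = 3 → phi k m (s * monomial u 1) = 0) :
    s ∈ Ann (dualElement (cubicF'' k m)) := by
  rw [mem_Ann_iff]
  intro t
  induction t using MvPolynomial.induction_on' with
  | monomial u r =>
    have : (monomial u r : MvPolynomial (Var m) k) = r • monomial u 1 := by
      simp [smul_monomial]
    rw [this, mul_smul_comm, map_smul]
    by_cases hu : n + u.degree = 3
    · rw [h u hu, smul_zero]
    · rw [phi_of_isHomogeneous (hs.mul (isHomogeneous_monomial 1 rfl)) hu, smul_zero]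
  | add p q hp hq => rw [mul_add, map_add, hp, hq, add_zero]

theorem mem_Ann_of_two [NeZero m] {s : MvPolynomial (Var m) k} (hs : s.IsHomogeneous 2)
    (h : ∀ z, phi k m (s * vr k z) = 0) : s ∈ Ann (dualElement (cubicF'' k m)) := by
  refine mem_Ann_of_isHomogeneous hs fun u hu => ?_
  obtain ⟨v, rfl⟩ : u ∈ Set.range (fun v : Var m => Finsupp.single v 1) := by
    rw [Finsupp.range_single_one]
    exact (by omega : u.degree = 1)
  simpa [vr, X] using h ((equivVar m).symm v)

theorem mem_Ann_of_three [NeZero m] {s : MvPolynomial (Var m) k} (hs : s.IsHomogeneous 3)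
    (h : phi k m s = 0) : s ∈ Ann (dualElement (cubicF'' k m)) := by
  refine mem_Ann_of_isHomogeneous hs fun u hu => ?_
  obtain rfl := (Finsupp.degree_eq_zero_iff u).1 (by omega)
  simpa using h

theorem mem_Ann_of_four_le [NeZero m] {s : MvPolynomial (Var m) k} {n : ℕ}
    (hs : s.IsHomogeneous n) (hn : 4 ≤ n) : s ∈ Ann (dualElement (cubicF'' k m)) :=
  mem_Ann_of_isHomogeneous hs fun u hu => by omega

/-- A product of two variables acts on the cubic through its complement alone; this and the next
lemma supply all the quadrics used below. -/
theorem mul_mem_Ann [NeZero m] (hm : 6 ≤ m) {x y : Vr (ZMod m)} (h : compl x y = none) :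
    vr k x * vr k y ∈ Ann (dualElement (cubicF'' k m)) :=
  mem_Ann_of_two ((vr_isHomogeneous x).mul (vr_isHomogeneous y)) fun z => by
    rw [phi_triple hm, h]
    simp

theorem sub_mem_Ann [NeZero m] (hm : 6 ≤ m) {x y z w : Vr (ZMod m)}
    (h : compl x y = compl z w) :
    vr k x * vr k y - vr k z * vr k w ∈ Ann (dualElement (cubicF'' k m)) :=
  mem_Ann_of_two (((vr_isHomogeneous x).mul (vr_isHomogeneous y)).sub
      ((vr_isHomogeneous z).mul (vr_isHomogeneous w))) fun v => by
    rw [sub_mul, map_sub, phi_triple hm, phi_triple hm, h, sub_self]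

theorem triple_mem_Ann [NeZero m] (hm : 6 ≤ m) {x y z : Vr (ZMod m)} (h : compl x y ≠ some z) :
    vr k x * vr k y * vr k z ∈ Ann (dualElement (cubicF'' k m)) :=
  mem_Ann_of_three (((vr_isHomogeneous x).mul (vr_isHomogeneous y)).mul (vr_isHomogeneous z)) <| by
    rw [phi_triple hm, if_neg h]

end

/-! ### Quartics modulo the square of the annihilator: the class of `y` times a term. -/

noncomputable section

variable {k : Type*} [Field k] {m : ℕ}

variable (k m) in
/-- The square of the annihilator of `F''`. -/
abbrev sqAnn [NeZero m] : Ideal (MvPolynomial (Var m) k) := Ann (dualElement (cubicF'' k m)) ^ 2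

variable (k) in
/-- A product of four variables. -/
def quad (x y z w : Vr (ZMod m)) : MvPolynomial (Var m) k := vr k x * vr k y * (vr k z * vr k w)

theorem quad_swap_left (x y z w : Vr (ZMod m)) : quad k x y z w = quad k y x z w := by
  simp only [quad]; ring

theorem quad_swap_right (x y z w : Vr (ZMod m)) : quad k x y z w = quad k x y w z := by
  simp only [quad]; ring

theorem quad_swap_mid (x y z w : Vr (ZMod m)) : quad k x y z w = quad k x z y w := by
  simp only [quad]; ring

theorem quad_isHomogeneous (x y z w : Vr (ZMod m)) : (quad k x y z w).IsHomogeneous 4 :=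
  ((vr_isHomogeneous x).mul (vr_isHomogeneous y)).mul
    ((vr_isHomogeneous z).mul (vr_isHomogeneous w))

theorem quad_mem_sqAnn [NeZero m] (hm : 6 ≤ m) {x y z w : Vr (ZMod m)} (h : compl x y = none)
    (h' : compl z w = none) : quad k x y z w ∈ sqAnn k m := by
  rw [sqAnn, pow_two]
  exact Ideal.mul_mem_mul (mul_mem_Ann hm h) (mul_mem_Ann hm h')

theorem quad_sub_mem_sqAnn [NeZero m] (hm : 6 ≤ m) {x y z w p q : Vr (ZMod m)}
    (h : compl x y = none) (h' : compl z w = compl p q) :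
    quad k x y z w - quad k x y p q ∈ sqAnn k m := by
  rw [sqAnn, pow_two, quad, quad, ← mul_sub]
  exact Ideal.mul_mem_mul (mul_mem_Ann hm h) (sub_mem_Ann hm h')

theorem quad_exchange_mem_sqAnn [NeZero m] (hm : 6 ≤ m) {x y z w x' y' z' w' : Vr (ZMod m)}
    (h : compl x y = compl x' y') (h' : compl z w = compl z' w') :
    quad k x y z w - quad k x' y' z w - quad k x y z' w' + quad k x' y' z' w' ∈ sqAnn k m := by
  rw [sqAnn, pow_two]
  convert Ideal.mul_mem_mul (sub_mem_Ann (k := k) hm h) (sub_mem_Ann hm h') using 1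
  simp only [quad]
  ring

/-- A pair of variables whose product with the given one is a term of the cubic. -/
def rep : Vr (ZMod m) → Vr (ZMod m) × Vr (ZMod m)
  | .a i => (.a (i - 1), .a i)
  | .b i => (.b (i - 1), .b i)
  | .c i => (.c (i - 1), .c i)
  | .d => (.a 0, .b 1)
  | .e => (.b 0, .c 1)

theorem natCast_ne_zero {n : ℕ} (h0 : 0 < n) (hn : n < m) : (n : ZMod m) ≠ 0 := fun h =>
  absurd (Nat.le_of_dvd h0 ((ZMod.natCast_eq_zero_iff n m).1 h)) (by omega)

theorem compl_rep (hm : 6 ≤ m) (x : Vr (ZMod m)) : compl (rep x).1 (rep x).2 = some x := by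
  have h1 : (1 : ZMod m) ≠ 0 := by exact_mod_cast natCast_ne_zero one_pos (by omega : 1 < m)
  cases x <;> simp [rep, compl, h1.symm]

variable (k) in
/-- The product of `y`, `x` and a pair complementary to `x`. -/
def star (y x : Vr (ZMod m)) : MvPolynomial (Var m) k := quad k y x (rep x).1 (rep x).2

theorem quad_sub_star_mem [NeZero m] (hm : 6 ≤ m) {y x z w : Vr (ZMod m)}
    (h : compl y x = none) (h' : compl z w = some x) :
    quad k y x z w - star k y x ∈ sqAnn k m :=
  quad_sub_mem_sqAnn hm h (by rw [h', compl_rep hm])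

/-- The monomial `y x x' u` can be read as `(y x)(x' u)` and as `(y x')(x u)`; the two readings
reduce to the two sides. -/
theorem star_sub_star_mem [NeZero m] (hm : 6 ≤ m) {y x x' u : Vr (ZMod m)}
    (h : compl y x = none) (h' : compl y x' = none) (hu : compl x x' = some u) :
    star k y x - star k y x' ∈ sqAnn k m := by
  have h1 := quad_sub_star_mem (k := k) hm h (compl_rotate hm hu)
  have h2 := quad_sub_star_mem (k := k) hm h' (compl_swap hm hu)
  have e : quad k y x x' u = quad k y x' x u := quad_swap_mid _ _ _ _
  rw [e] at h1
  convert Ideal.sub_mem _ h2 h1 using 1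
  ring

/-- A chosen variable which is not in a common term with the given one. -/
def base : Vr (ZMod m) → Vr (ZMod m)
  | .a _ => .e
  | .b i => .a (i + 1)
  | .c _ => .d
  | .d => .e
  | .e => .d

theorem base_ne (y : Vr (ZMod m)) : base y ≠ y := by
  cases y <;> simp [base]

theorem compl_base (hm : 6 ≤ m) (y : Vr (ZMod m)) : compl y (base y) = none := by
  have h1 : (1 : ZMod m) ≠ 0 := by exact_mod_cast natCast_ne_zero one_pos (by omega : 1 < m)
  have h2 : (2 : ZMod m) ≠ 0 := by exact_mod_cast natCast_ne_zero two_pos (by omega : 2 < m)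
  cases y with
  | b i =>
    have h2' : i ≠ i + 1 + 1 := fun h => h2 (by linear_combination -h)
    simp [base, compl, h1, h2']
  | _ => rfl

/-- Consecutive `a`'s are linked by the terms `a_l a_{l+1}^2`, so one can walk from `a_{i+1}` around
the cycle, stopping before `a_{i-1}` and `a_i`, which are related to `b_i`. -/
theorem star_b_a [NeZero m] (hm : 6 ≤ m) {i l : ZMod m} (h : compl (.b i) (.a l) = none) :
    star k (.b i) (.a l) - star k (.b i) (base (.b i)) ∈ sqAnn k m := by
  have hn : ∀ n : ℕ, n + 2 < m → compl (.b i) (.a (i + 1 + n)) = none := by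
    intro n hn
    have h1 : i + 1 + n ≠ i := fun h => natCast_ne_zero (m := m) (n := n + 1) (by omega) (by omega)
      (by push_cast; linear_combination h)
    have h2 : i ≠ i + 1 + n + 1 := fun h => natCast_ne_zero (m := m) (n := n + 2) (by omega)
      (by omega) (by push_cast; linear_combination -h)
    simp [compl, h1, h2]
  have key : ∀ n : ℕ, n + 2 < m →
      star k (.b i) (.a (i + 1 + n)) - star k (.b i) (base (.b i)) ∈ sqAnn k m := by
    intro n
    induction n with
    | zero => intro _; simp [base]
    | succ n ih =>
      intro hn'
      have h1 := ih (by omega)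
      have h2 := star_sub_star_mem (k := k) hm (hn (n + 1) hn') (hn n (by omega))
        (u := .a (i + 1 + (n + 1 : ℕ))) (by
          have : i + 1 + (n : ZMod m) ≠ i + 1 + (n + 1 : ℕ) + 1 := fun h =>
            natCast_ne_zero (m := m) (n := 2) (by omega) (by omega)
              (by push_cast at h ⊢; linear_combination -h)
          simp only [compl, if_neg this]
          rw [if_pos (by push_cast; ring)])
      convert Ideal.add_mem _ h1 h2 using 1
      ring
  have hv : i + 1 + ((l - i - 1).val : ZMod m) = l := by
    rw [ZMod.natCast_zmod_val]; ring
  have hlt := ZMod.val_lt (l - i - 1)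
  -- The offsets `m - 2` and `m - 1` correspond to `l = i - 1` and `l = i`, both excluded by `h`.
  have := key (l - i - 1).val (by
    by_contra hcon
    have hl : ¬ l = i ∧ ¬ i = l + 1 := by
      simp only [compl] at h
      split_ifs at h
      exact ⟨by assumption, by assumption⟩
    rcases (by omega : (l - i - 1).val + 2 = m ∨ (l - i - 1).val + 1 = m) with h3 | h3
    · have h4 := congrArg (Nat.cast : ℕ → ZMod m) h3
      push_cast at h4
      rw [ZMod.natCast_zmod_val, ZMod.natCast_self] at h4
      exact hl.2 (by linear_combination -h4)
    · have h4 := congrArg (Nat.cast : ℕ → ZMod m) h3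
      push_cast at h4
      rw [ZMod.natCast_zmod_val, ZMod.natCast_self] at h4
      exact hl.1 (by linear_combination h4))
  rwa [hv] at this

/-- Consider the graph on the variables other than `y` and unrelated to `y`, with edges between
related variables. It is connected: each case exhibits a path from `x` to `base y`. -/
theorem star_sub_base_mem [NeZero m] (hm : 6 ≤ m) {y x : Vr (ZMod m)} (hne : x ≠ y)
    (h : compl y x = none) : star k y x - star k y (base y) ∈ sqAnn k m := by
  have h1 : (1 : ZMod m) ≠ 0 := by exact_mod_cast natCast_ne_zero one_pos (by omega : 1 < m)
  have h2 : (2 : ZMod m) ≠ 0 := by exact_mod_cast natCast_ne_zero two_pos (by omega : 2 < m)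
  have h3 : (3 : ZMod m) ≠ 0 := by exact_mod_cast natCast_ne_zero three_pos (by omega : 3 < m)
  have link : ∀ {y x x' u : Vr (ZMod m)}, compl y x = none → compl y x' = none →
      compl x x' = some u → star k y x' - star k y (base y) ∈ sqAnn k m →
      star k y x - star k y (base y) ∈ sqAnn k m := by
    intro y x x' u hx hx' hu h
    convert Ideal.add_mem _ (star_sub_star_mem (k := k) hm hx hx' hu) h using 1
    ring
  have self : ∀ y : Vr (ZMod m), star k y (base y) - star k y (base y) ∈ sqAnn k m := fun y => by
    simp
  have hb : ∀ y : Vr (ZMod m), compl y (base y) = none := compl_base hm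
  cases y with
  | d =>
    cases x with
    | c l => exact link h (hb _) (x' := .e) rfl (self _)
    | e => exact self _
    | d => exact absurd rfl hne
    | _ => simp [compl] at h
  | e =>
    cases x with
    | a l => exact link h (hb _) (x' := .d) rfl (self _)
    | d => exact self _
    | e => exact absurd rfl hne
    | _ => simp [compl] at h
  | a i =>
    cases x with
    | d => simp [compl] at h
    | e => exact self _
    | b l => exact link h (hb _) (x' := .e) rfl (self _)
    | c l => exact link h (hb _) (x' := .e) rfl (self _)
    | a l =>
      have hl : i ≠ l := fun hl => by simp [compl, hl, h1] at h
      have hc : compl (.a i) (.c l) = none := by simp [compl, hl]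
      exact link h hc (u := .b l) (by simp [compl]) (link hc (hb _) (x' := .e) rfl (self _))
  | c i =>
    cases x with
    | e => simp [compl] at h
    | d => exact self _
    | a l => exact link h (hb _) (x' := .d) rfl (self _)
    | b l => exact link h (hb _) (x' := .d) rfl (self _)
    | c l =>
      have hl : l ≠ i := fun hl => by simp [compl, hl, h1] at h
      have hc : compl (.c i) (.a l) = none := by simp [compl, hl]
      exact link h hc (u := .b l) (by simp [compl]) (link hc (hb _) (x' := .d) rfl (self _))
  | b i =>
    cases x with
    | d => simp [compl] at h
    | e => simp [compl] at h
    | a l => exact star_b_a hm h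
    | b l =>
      have hl : l ≠ i ∧ i ≠ l + 1 := by
        constructor
        · rintro rfl
          simp [compl, h1] at h
        · rintro rfl
          simp only [compl, if_true] at h
          split_ifs at h
      have hc : compl (.b i) (.a l) = none := by simp [compl, hl.1, hl.2]
      exact link h hc (u := .c l) (by simp [compl]) (star_b_a hm hc)
    | c l =>
      have hl : i ≠ l ∧ l ≠ i + 1 := by
        constructor
        · rintro rfl
          simp [compl] at h
        · rintro rfl
          simp [compl, h1] at h
      -- If `i = l + 1`, then `a_l` is related to `b_i` through `a_l b_{l+1} d`, so the path from
      -- `c_l` makes a detour through `c_{l-1}` and `a_{l-1}`.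
      by_cases hl' : i = l + 1
      · subst hl'
        have e1 : ¬ l - 1 = l + 1 := fun h => h2 (by linear_combination -h)
        have e2 : ¬ l + 1 = l - 1 + 1 := fun h => h1 (by linear_combination h)
        have e3 : ¬ l + 1 = l - 1 := fun h => h2 (by linear_combination h)
        have e4 : ¬ l - 1 = l + 1 + 1 := fun h => h3 (by linear_combination -h)
        have hc : compl (.b (l + 1)) (.a (l - 1)) = none := by simp [compl, e1, h1]
        have hc' : compl (.b (l + 1)) (.c (l - 1)) = none := by simp [compl, e3, e4]
        have e5 : ¬ l - 1 = l + 1 := e1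
        exact link h hc' (u := .c l) (by simp [compl, e5])
          (link hc' hc (u := .b (l - 1)) (by simp [compl]) (star_b_a hm hc))
      · have hc : compl (.b i) (.a l) = none := by simp [compl, hl.1.symm, hl']
        exact link h hc (u := .b l) (by simp [compl]) (star_b_a hm hc)

variable (k) in
/-- The distinguished quartic multiples of the variables. -/
def eps (y : Vr (ZMod m)) : MvPolynomial (Var m) k := star k y (base y)

theorem quad_sub_eps_mem [NeZero m] (hm : 6 ≤ m) {y x z w : Vr (ZMod m)} (hne : x ≠ y)
    (h : compl y x = none) (h' : compl z w = some x) :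
    quad k y x z w - eps k y ∈ sqAnn k m := by
  convert Ideal.add_mem _ (quad_sub_star_mem (k := k) hm h h') (star_sub_base_mem hm hne h) using 1
  rw [eps]
  ring

/-! ### Reachable quartics, and the vanishing in degree five. -/

variable (k m) in
/-- The span of the distinguished quartics and the square of the annihilator. -/
def reach [NeZero m] : Submodule k (MvPolynomial (Var m) k) :=
  (sqAnn k m).restrictScalars k ⊔ Submodule.span k (Set.range (eps k))

theorem mem_reach_of_mem [NeZero m] {s : MvPolynomial (Var m) k} (h : s ∈ sqAnn k m) :
    s ∈ reach k m := Submodule.mem_sup_left h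

theorem mem_reach_of_sub [NeZero m] {s t : MvPolynomial (Var m) k} (h : s - t ∈ sqAnn k m)
    (ht : t ∈ reach k m) : s ∈ reach k m := by
  simpa using add_mem (mem_reach_of_mem h) ht

theorem quad_mem_reach_of_eq [NeZero m] (hm : 6 ≤ m) {y x z w : Vr (ZMod m)} (hne : x ≠ y)
    (h : compl y x = none) (h' : compl z w = some x) : quad k y x z w ∈ reach k m :=
  mem_reach_of_sub (quad_sub_eps_mem hm hne h h')
    (Submodule.mem_sup_right (Submodule.subset_span ⟨y, rfl⟩))

/-- The product of the binomials `x y - x' y'` and `z w - z' w'` ties four monomials together, so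
three of them determine the fourth. -/
theorem quad_mem_reach_of_exchange [NeZero m] (hm : 6 ≤ m) {x y z w x' y' z' w' : Vr (ZMod m)}
    (h : compl x y = compl x' y') (h' : compl z w = compl z' w')
    (h1 : quad k x' y' z w ∈ reach k m) (h2 : quad k x y z' w' ∈ reach k m)
    (h3 : quad k x' y' z' w' ∈ reach k m) : quad k x y z w ∈ reach k m := by
  have := add_mem (mem_reach_of_mem (quad_exchange_mem_sqAnn (k := k) hm h h'))
    (sub_mem (add_mem h1 h2) h3)
  convert this using 1
  ring

theorem exists_avoiding (hm : 6 ≤ m) (s : Finset (ZMod m)) (hs : s.card ≤ 5) :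
    ∃ l, l ∉ s := by
  have : NeZero m := ⟨by omega⟩
  by_contra! hcon
  have : s = Finset.univ := Finset.eq_univ_iff_forall.2 hcon
  rw [this, Finset.card_univ, ZMod.card] at hs
  omega

/-- Since `eps y` may be computed with any admissible term, take a term `p q r` with `p` unrelated
to `v` and `p ≠ y`. Then `v p` annihilates the cubic, and so does `q r y`, which is not a term. -/
theorem vr_mul_eps_mem [NeZero m] (hm : 6 ≤ m) (v y : Vr (ZMod m)) :
    vr k v * eps k y ∈ sqAnn k m := by
  have h1 : (1 : ZMod m) ≠ 0 := by exact_mod_cast natCast_ne_zero one_pos (by omega : 1 < m)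
  /- It suffices to find a term `p q r` with suitable incidences. -/
  have key : ∀ p q r x z w : Vr (ZMod m), compl q r = some p → compl v p = none → p ≠ y →
      compl y x = none → x ≠ y → compl z w = some x →
      vr k x * (vr k z * vr k w) = vr k p * (vr k q * vr k r) →
      vr k v * eps k y ∈ sqAnn k m := by
    intro p q r x z w hp hv hpy hx hxy hzw he
    have h2 := Ideal.mul_mem_left _ (vr k v) (quad_sub_eps_mem (k := k) hm hxy hx hzw)
    have h3 : vr k v * vr k p * (vr k q * vr k r * vr k y) ∈ sqAnn k m := by
      rw [sqAnn, pow_two]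
      refine Ideal.mul_mem_mul (mul_mem_Ann hm hv) (triple_mem_Ann hm ?_)
      rw [hp]
      simpa using hpy
    convert Ideal.sub_mem _ h3 h2 using 1
    simp only [quad]
    linear_combination vr k v * vr k y * he
  -- `i` and `j` are the indices of `y` and `v`, and are arbitrary if the variable is `d` or `e`.
  -- Five residues are then avoided, which leaves one because `m ≥ 6`.
  obtain ⟨i, j, hi, hj⟩ : ∃ i j : ZMod m,
      (y = .a i ∨ y = .b i ∨ y = .c i ∨ y = .d ∨ y = .e) ∧
      (v = .a j ∨ v = .b j ∨ v = .c j ∨ v = .d ∨ v = .e) := by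
    cases y <;> cases v <;> simp
  obtain ⟨l, hl⟩ := exists_avoiding hm {i, i - 1, j, j - 1, j + 1} Finset.card_le_five
  simp only [Finset.mem_insert, Finset.mem_singleton, not_or] at hl
  obtain ⟨l1, l2, l3, l4, l5⟩ := hl
  have l2' : i ≠ l + 1 := fun h => l2 (by linear_combination -h)
  obtain ⟨x, z, w, hx, hxy, hzw, he⟩ : ∃ x z w : Vr (ZMod m), compl y x = none ∧ x ≠ y ∧
      compl z w = some x ∧ vr k x * (vr k z * vr k w)
        = vr k (.a l) * (vr k (.b l) * vr k (.c l)) := by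
    rcases hi with rfl | rfl | rfl | rfl | rfl
    · exact ⟨.c l, .a l, .b l, by simp [compl, Ne.symm l1], by simp, by simp [compl], by ring⟩
    · exact ⟨.a l, .b l, .c l, by simp [compl, l1, l2'], by simp, by simp [compl], by ring⟩
    · exact ⟨.a l, .b l, .c l, by simp [compl, l1], by simp, by simp [compl], by ring⟩
    · exact ⟨.c l, .a l, .b l, by simp [compl], by simp, by simp [compl], by ring⟩
    · exact ⟨.a l, .b l, .c l, by simp [compl], by simp, by simp [compl], by ring⟩
  have hpa : Vr.a l ≠ y := by
    rcases hi with rfl | rfl | rfl | rfl | rfl <;> simp [l1]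
  have hpc : Vr.c l ≠ y := by
    rcases hi with rfl | rfl | rfl | rfl | rfl <;> simp [l1]
  have ha : compl v (.a l) = none → vr k v * eps k y ∈ sqAnn k m := fun hv =>
    key (.a l) (.b l) (.c l) x z w (by simp [compl]) hv hpa hx hxy hzw he
  have hc : compl v (.c l) = none → vr k v * eps k y ∈ sqAnn k m := fun hv =>
    key (.c l) (.a l) (.b l) x z w (by simp [compl]) hv hpc hx hxy hzw (he.trans (by ring))
  rcases hj with rfl | rfl | rfl | rfl | rfl
  · exact hc (by simp [compl, Ne.symm l3])
  · exact hc (by simp [compl, Ne.symm l3, l5])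
  · exact ha (by simp [compl, l3])
  · exact hc (by simp [compl])
  · exact ha (by simp [compl])

end

/-! ### Symbolic search over local configurations. -/

/-- Symbolic indices: the positions `10 s + p` with `p < 10` stand for `p` consecutive indices of
the `s`-th block. `apart p q` says that the indices are surely neither equal nor consecutive. -/
def apart (p q : ℕ) : Bool :=
  if p < 10 then
    if q < 10 then (p + 2 ≤ q && q ≤ p + 4) || (q + 2 ≤ p && p ≤ q + 4)
    else (q == 15 || q == 25) && 4 ≤ p && p ≤ 6
  else q < 10 && (p == 15 || p == 25) && 4 ≤ q && q ≤ 6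

/-- `q` is the position following `p`, in the same block. -/
def follows (p q : ℕ) : Bool := q == p + 1 && p % 10 != 9

/-- The complement of a pair of symbolic variables, where it is known. -/
def symCompl : Vr ℕ → Vr ℕ → Option (Vr ℕ)
  | .a i, .a j => if follows i j then some (.a j) else if follows j i then some (.a i)
      else if i == j && i % 10 != 0 then some (.a (i - 1)) else none
  | .b i, .b j => if follows i j then some (.b j) else if follows j i then some (.b i)
      else if i == j && i % 10 != 0 then some (.b (i - 1)) else none
  | .c i, .c j => if follows i j then some (.c j) else if follows j i then some (.c i)
      else if i == j && i % 10 != 0 then some (.c (i - 1)) else none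
  | .a i, .b j => if i == j then some (.c i) else if follows i j then some .d else none
  | .b j, .a i => if i == j then some (.c i) else if follows i j then some .d else none
  | .a i, .c j => if i == j then some (.b i) else none
  | .c j, .a i => if i == j then some (.b i) else none
  | .b i, .c j => if i == j then some (.a i) else if follows i j then some .e else none
  | .c j, .b i => if i == j then some (.a i) else if follows i j then some .e else none
  | .a i, .d => if i % 10 != 9 then some (.b (i + 1)) else none
  | .d, .a i => if i % 10 != 9 then some (.b (i + 1)) else none
  | .b i, .d => if i % 10 != 0 then some (.a (i - 1)) else none
  | .d, .b i => if i % 10 != 0 then some (.a (i - 1)) else none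
  | .b i, .e => if i % 10 != 9 then some (.c (i + 1)) else none
  | .e, .b i => if i % 10 != 9 then some (.c (i + 1)) else none
  | .c i, .e => if i % 10 != 0 then some (.b (i - 1)) else none
  | .e, .c i => if i % 10 != 0 then some (.b (i - 1)) else none
  | _, _ => none

/-- The two symbolic variables surely have no complement. -/
def symNone : Vr ℕ → Vr ℕ → Bool
  | .a i, .a j => apart i j
  | .b i, .b j => apart i j
  | .c i, .c j => apart i j
  | .a i, .b j => apart i j || follows j i
  | .b j, .a i => apart i j || follows j i
  | .a i, .c j => apart i j || follows i j || follows j i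
  | .c j, .a i => apart i j || follows i j || follows j i
  | .b i, .c j => apart i j || follows j i
  | .c j, .b i => apart i j || follows j i
  | .a _, .e => true
  | .e, .a _ => true
  | .c _, .d => true
  | .d, .c _ => true
  | .d, .d => true
  | .d, .e => true
  | .e, .d => true
  | .e, .e => true
  | _, _ => false

/-- Pairs of symbolic variables with the given complement. -/
def symReps : Vr ℕ → List (Vr ℕ × Vr ℕ)
  | .a p => [(.a (p - 1), .a p), (.a (p + 1), .a (p + 1)), (.b p, .c p), (.b (p + 1), .d)]
  | .b p => [(.b (p - 1), .b p), (.b (p + 1), .b (p + 1)), (.a p, .c p), (.a (p - 1), .d),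
      (.c (p + 1), .e)]
  | .c p => [(.c (p - 1), .c p), (.c (p + 1), .c (p + 1)), (.a p, .b p), (.b (p - 1), .e)]
  | .d => [2, 3, 4, 5, 6, 7].map fun p => (.a p, .b (p + 1))
  | .e => [2, 3, 4, 5, 6, 7].map fun p => (.b p, .c (p + 1))

/-- Some complementary pair of `t` passes the test `g`. -/
def anyRep (t : Vr ℕ) (g : Vr ℕ → Vr ℕ → Bool) : Bool :=
  (symReps t).any fun p => decide (symCompl p.1 p.2 = some t) && g p.1 p.2

/-- One step of the search for a proof that `x y z w` is reachable, for the pairing `x y`, `z w`;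
the test `g` is applied to the products obtained by an exchange of `z w`. -/
def symStep (g : Vr ℕ → Vr ℕ → Vr ℕ → Vr ℕ → Bool) (x y z w : Vr ℕ) : Bool :=
  symNone x y && (symNone z w ||
    match symCompl z w with
    | some t => ((decide (t = x) || decide (t = y)) && decide (x ≠ y)) || anyRep t (g x y)
    | none => false)

/-- A search step over all pairings. -/
def symSteps (g : Vr ℕ → Vr ℕ → Vr ℕ → Vr ℕ → Bool) (x y z w : Vr ℕ) : Bool :=
  symStep g x y z w || symStep g z w x y || symStep g x z y w || symStep g y w x z ||
    symStep g x w y z || symStep g y z x w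

/-- The search of depth `n`. -/
def symGood : ℕ → Vr ℕ → Vr ℕ → Vr ℕ → Vr ℕ → Bool
  | 0 => symSteps fun _ _ _ _ => false
  | n + 1 => symSteps (symGood n)

/-- Search for an exchange of both `x y` and `z w`. -/
def symExchange (g : Vr ℕ → Vr ℕ → Vr ℕ → Vr ℕ → Bool) (x y z w : Vr ℕ) : Bool :=
  match symCompl x y, symCompl z w with
  | some s, some t => anyRep s fun x' y' => g x' y' z w && anyRep t fun z' w' =>
      g x y z' w' && g x' y' z' w'
  | _, _ => false

/-- Search for a double exchange over all pairings. -/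
def symExchanges (g : Vr ℕ → Vr ℕ → Vr ℕ → Vr ℕ → Bool) (x y z w : Vr ℕ) : Bool :=
  symExchange g x y z w || symExchange g x z y w || symExchange g x w y z

/-- The search used for products of four pairwise related variables. -/
def symClique (x y z w : Vr ℕ) : Bool :=
  symNone x y || symNone x z || symNone x w || symNone y z || symNone y w || symNone z w ||
    symExchanges (symGood 0) x y z w || symExchanges (symGood 1) x y z w ||
    symExchanges (fun p q r s => symGood 0 p q r s || symExchanges (symGood 0) p q r s) x y z w

/-- The variables with index in a set of positions, and `d`, `e`. -/
def window (l : List ℕ) : List (Vr ℕ) :=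
  .d :: .e :: (l.map .a ++ l.map .b ++ l.map .c)

/-- The search used for the product of `x y` with a pair complementary to `t`. -/
def symPair (t x y : Vr ℕ) : Bool :=
  decide (x = t) || decide (y = t) || (symCompl x y).isSome ||
    anyRep t (symGood 0 x y) || anyRep t (symGood 1 x y) || anyRep t (symGood 2 x y)

/-- Pairs complementary to `t` can be taken at positions 4 to 6, or with `d` or `e`, and these
relate to indexed variables only at positions 3 to 7. Every other index behaves like a far one.
Positions 15 and 25 keep the far indices of `x` and `y` separate, with nothing assumed about their
mutual position. -/
theorem window_symPair : ∀ t ∈ [Vr.a 5, Vr.b 5, Vr.c 5],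
    ∀ x ∈ window [3, 4, 5, 6, 7, 15], ∀ y ∈ window [3, 4, 5, 6, 7, 25],
      symPair t x y = true := by
  decide +kernel

/-- Here `t` has no index, so the window is centred at `x`. -/
theorem window_symPair_de : ∀ t ∈ [Vr.d, Vr.e],
    ∀ x ∈ [Vr.a 5, Vr.b 5, Vr.c 5], ∀ y ∈ window [3, 4, 5, 6, 7, 15],
      symPair t x y = true := by
  decide +kernel

theorem symPair_de : ∀ t ∈ [Vr.d, Vr.e], ∀ x ∈ [Vr.d, Vr.e], ∀ y ∈ [Vr.d, Vr.e],
    symPair t x y = true := by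
  decide +kernel

/-- Indexed variables related to `x` are at distance at most 1, so positions 4 to 6 suffice.
Products with an unrelated pair pass the test at once, being treated separately. -/
theorem window_symClique : ∀ x ∈ [Vr.a 5, Vr.b 5, Vr.c 5], ∀ y ∈ window [4, 5, 6],
    ∀ z ∈ window [4, 5, 6], ∀ w ∈ window [4, 5, 6], symClique x y z w = true := by
  decide +kernel

/-- This covers the case where an unrelated pair `x x` meets a pair with complement `x` itself,
which defines no `eps`. -/
theorem symExchanges_de : symExchanges (symGood 1) .d .d (.a 5) (.b 6) = true ∧
    symExchanges (symGood 1) .e .e (.b 5) (.c 6) = true := by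
  decide +kernel

/-! ### Soundness of the symbolic search. -/

variable {m : ℕ}

/-- The interpretation `ρ` of the symbolic indices respects their relations. -/
structure Realizes (ρ : ℕ → ZMod m) : Prop where
  succ : ∀ p, p % 10 ≠ 9 → ρ (p + 1) = ρ p + 1
  apart : ∀ p q, apart p q = true → ρ p ≠ ρ q ∧ ρ q ≠ ρ p + 1 ∧ ρ p ≠ ρ q + 1

theorem Realizes.pred {ρ : ℕ → ZMod m} (hρ : Realizes ρ) {p : ℕ} (hp : p % 10 ≠ 0) :
    ρ (p - 1) = ρ p - 1 := by
  have := hρ.succ (p - 1) (by omega)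
  rw [show p - 1 + 1 = p by omega] at this
  rw [this]
  ring

theorem Realizes.follows {ρ : ℕ → ZMod m} (hρ : Realizes ρ) {p q : ℕ}
    (h : follows p q = true) : ρ q = ρ p + 1 := by
  simp only [Apolarity.follows, Bool.and_eq_true, beq_iff_eq, bne_iff_ne] at h
  rw [h.1, hρ.succ p h.2]

/-- Only positive answers are meaningful: `none` means that nothing is known, which is why
unrelatedness is certified by the separate test `symNone`. -/
theorem symCompl_sound (hm : 6 ≤ m) {ρ : ℕ → ZMod m} (hρ : Realizes ρ) {x y z : Vr ℕ}
    (h : symCompl x y = some z) : compl (x.map ρ) (y.map ρ) = some (z.map ρ) := by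
  have h1 : (1 : ZMod m) ≠ 0 := by exact_mod_cast natCast_ne_zero one_pos (by omega : 1 < m)
  have h2 : (2 : ZMod m) ≠ 0 := by exact_mod_cast natCast_ne_zero two_pos (by omega : 2 < m)
  have h2' : ∀ i : ZMod m, i ≠ i + 1 + 1 := fun i h => h2 (by linear_combination -h)
  cases x <;> cases y <;> simp only [symCompl] at h <;> (try split_ifs at h) <;>
    simp only [Option.some.injEq, reduceCtorEq] at h <;> subst h <;>
    simp only [Vr.map, compl] <;>
    first
    | rfl
    | (rename_i h
       simp [hρ.follows h, h1, h2']; done)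
    | (rename_i h
       rw [beq_iff_eq] at h
       simp [h]; done)
    | (rename_i h
       rw [Bool.and_eq_true, beq_iff_eq, bne_iff_ne] at h
       obtain ⟨rfl, h⟩ := h
       simp [hρ.pred h, h1]; done)
    | (rename_i h
       rw [bne_iff_ne] at h
       first
       | rw [hρ.pred h]
       | rw [hρ.succ _ h])

theorem symNone_sound (hm : 6 ≤ m) {ρ : ℕ → ZMod m} (hρ : Realizes ρ) {x y : Vr ℕ}
    (h : symNone x y = true) : compl (x.map ρ) (y.map ρ) = none := by
  have h1 : (1 : ZMod m) ≠ 0 := by exact_mod_cast natCast_ne_zero one_pos (by omega : 1 < m)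
  have h2 : (2 : ZMod m) ≠ 0 := by exact_mod_cast natCast_ne_zero two_pos (by omega : 2 < m)
  have h2' : ∀ i : ZMod m, i ≠ i + 1 + 1 := fun i h => h2 (by linear_combination -h)
  cases x <;> cases y <;> simp only [symNone, Bool.or_eq_true, reduceCtorEq] at h <;>
    simp only [Vr.map, compl] <;>
    first
    | (obtain ⟨e1, e2, e3⟩ := hρ.apart _ _ h
       simp [e1, e2, e3]; done)
    | (rcases h with h | h
       · obtain ⟨e1, e2, e3⟩ := hρ.apart _ _ h
         simp [e1, e2, e3]
       · rw [hρ.follows h]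
         simp [h1, h2']; done)
    | (rcases h with (h | h) | h
       · obtain ⟨e1, e2, e3⟩ := hρ.apart _ _ h
         simp [e1, e2, e3]
       · rw [hρ.follows h]
         simp [h1]
       · rw [hρ.follows h]
         simp [h1]; done)

/-- Each of `a_i`, `b_i`, `c_i` occurs squared in some term. -/
theorem eq_d_or_eq_e (hm : 6 ≤ m) {x : Vr (ZMod m)} (h : compl x x = none) :
    x = .d ∨ x = .e := by
  have h1 : (1 : ZMod m) ≠ 0 := by exact_mod_cast natCast_ne_zero one_pos (by omega : 1 < m)
  cases x <;> simp [compl, h1] at h ⊢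

/-- Distinct symbols may denote the same variable. If they did here, it would be unrelated to
itself, hence `d` or `e`, and these have only one symbol each. -/
theorem map_ne (hm : 6 ≤ m) {ρ : ℕ → ZMod m} {x y : Vr ℕ}
    (h : compl (x.map ρ) (y.map ρ) = none) (hne : x ≠ y) : x.map ρ ≠ y.map ρ := by
  intro he
  rw [← he] at h
  have h1 := eq_d_or_eq_e hm h
  have h2 := h1
  rw [he] at h2
  revert h1 h2 he hne
  cases x <;> cases y <;> simp [Vr.map]

section

variable (k : Type*) [Field k] [NeZero m]

/-- The product of the interpretations of four symbolic variables is reachable. -/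
def Reached (ρ : ℕ → ZMod m) (x y z w : Vr ℕ) : Prop :=
  quad k (x.map ρ) (y.map ρ) (z.map ρ) (w.map ρ) ∈ reach k m

variable {k} {ρ : ℕ → ZMod m} {g : Vr ℕ → Vr ℕ → Vr ℕ → Vr ℕ → Bool}

theorem Reached.pair {x y z w : Vr ℕ} (h : Reached k ρ z w x y) : Reached k ρ x y z w := by
  have e : ∀ p q r s : Vr (ZMod m), quad k r s p q = quad k p q r s := fun p q r s => by
    simp only [quad]; ring
  rwa [Reached, e] at h

theorem Reached.mid {x y z w : Vr ℕ} (h : Reached k ρ x z y w) : Reached k ρ x y z w := by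
  rwa [Reached, quad_swap_mid] at h

theorem Reached.right {x y z w : Vr ℕ} (h : Reached k ρ x y w z) : Reached k ρ x y z w := by
  rwa [Reached, quad_swap_right] at h

theorem anyRep_sound {t : Vr ℕ} {f : Vr ℕ → Vr ℕ → Bool} (h : anyRep t f = true) :
    ∃ p q, symCompl p q = some t ∧ f p q = true := by
  simp only [anyRep, List.any_eq_true, Bool.and_eq_true, decide_eq_true_eq] at h
  obtain ⟨⟨p, q⟩, -, h1, h2⟩ := h
  exact ⟨p, q, h1, h2⟩

theorem symStep_sound (hm : 6 ≤ m) (hρ : Realizes ρ)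
    (hg : ∀ x y z w, g x y z w = true → Reached k ρ x y z w) {x y z w : Vr ℕ}
    (h : symStep g x y z w = true) : Reached k ρ x y z w := by
  simp only [symStep, Bool.and_eq_true, Bool.or_eq_true] at h
  obtain ⟨hxy, h⟩ := h
  have hxy' := symNone_sound hm hρ hxy
  rcases h with h | h
  · exact mem_reach_of_mem (quad_mem_sqAnn hm hxy' (symNone_sound hm hρ h))
  · split at h
    · rename_i t ht
      have ht' := symCompl_sound hm hρ ht
      simp only [Bool.and_eq_true, Bool.or_eq_true, decide_eq_true_eq] at h
      rcases h with ⟨rfl | rfl, hne⟩ | h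
      · have := quad_mem_reach_of_eq (k := k) hm (map_ne hm hxy' hne)
          ((compl_comm hm _ _).trans hxy') ht'
        rwa [quad_swap_left] at this
      · exact quad_mem_reach_of_eq hm (map_ne hm hxy' hne).symm hxy' ht'
      · obtain ⟨p, q, hpq, h⟩ := anyRep_sound h
        exact mem_reach_of_sub (quad_sub_mem_sqAnn hm hxy'
          (ht'.trans (symCompl_sound hm hρ hpq).symm)) (hg _ _ _ _ h)
    · simp at h

theorem symSteps_sound (hm : 6 ≤ m) (hρ : Realizes ρ)
    (hg : ∀ x y z w, g x y z w = true → Reached k ρ x y z w) {x y z w : Vr ℕ}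
    (h : symSteps g x y z w = true) : Reached k ρ x y z w := by
  simp only [symSteps, Bool.or_eq_true] at h
  rcases h with ((((h | h) | h) | h) | h) | h <;> have h' := symStep_sound hm hρ hg h
  · exact h'
  · exact h'.pair
  · exact h'.mid
  · exact h'.pair.mid
  · exact h'.mid.right
  · exact h'.pair.mid.right

theorem symGood_sound (hm : 6 ≤ m) (hρ : Realizes ρ) : ∀ (n : ℕ) (x y z w : Vr ℕ),
    symGood n x y z w = true → Reached k ρ x y z w
  | 0, _, _, _, _, h => symSteps_sound hm hρ (by simp) h
  | n + 1, _, _, _, _, h => symSteps_sound hm hρ (symGood_sound hm hρ n) h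

theorem symExchange_sound (hm : 6 ≤ m) (hρ : Realizes ρ)
    (hg : ∀ x y z w, g x y z w = true → Reached k ρ x y z w) {x y z w : Vr ℕ}
    (h : symExchange g x y z w = true) : Reached k ρ x y z w := by
  rw [symExchange] at h
  split at h
  · rename_i s t hs ht
    obtain ⟨x', y', hs', h⟩ := anyRep_sound h
    rw [Bool.and_eq_true] at h
    obtain ⟨h1, h⟩ := h
    obtain ⟨z', w', ht', h⟩ := anyRep_sound h
    rw [Bool.and_eq_true] at h
    exact quad_mem_reach_of_exchange hm
      ((symCompl_sound hm hρ hs).trans (symCompl_sound hm hρ hs').symm)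
      ((symCompl_sound hm hρ ht).trans (symCompl_sound hm hρ ht').symm)
      (hg _ _ _ _ h1) (hg _ _ _ _ h.1) (hg _ _ _ _ h.2)
  · simp at h

theorem symExchanges_sound (hm : 6 ≤ m) (hρ : Realizes ρ)
    (hg : ∀ x y z w, g x y z w = true → Reached k ρ x y z w) {x y z w : Vr ℕ}
    (h : symExchanges g x y z w = true) : Reached k ρ x y z w := by
  simp only [symExchanges, Bool.or_eq_true] at h
  rcases h with (h | h) | h <;> have h' := symExchange_sound hm hρ hg h
  · exact h'
  · exact h'.mid
  · exact h'.mid.right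

/-- The hypothesis `hN` stands for the case of an unrelated pair, later supplied by
`quad_mem_reach_of_none`. -/
theorem symClique_sound (hm : 6 ≤ m) (hρ : Realizes ρ) {x y z w : Vr ℕ}
    (h : symClique x y z w = true)
    (hN : ∀ p q r s : Vr (ZMod m), compl p q = none → quad k p q r s ∈ reach k m) :
    Reached k ρ x y z w := by
  have hN' : ∀ p q r s : Vr ℕ, symNone p q = true → Reached k ρ p q r s := fun p q r s h =>
    hN _ _ _ _ (symNone_sound hm hρ h)
  simp only [symClique, Bool.or_eq_true] at h
  rcases h with (((((((h | h) | h) | h) | h) | h) | h) | h) | h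
  · exact hN' _ _ _ _ h
  · exact (hN' _ _ _ _ h).mid
  · exact (hN' _ _ _ _ h).mid.right
  · exact (hN' _ _ _ _ h).pair.mid.right
  · exact (hN' _ _ _ _ h).pair.mid
  · exact (hN' _ _ _ _ h).pair
  · exact symExchanges_sound hm hρ (symGood_sound hm hρ 0) h
  · exact symExchanges_sound hm hρ (symGood_sound hm hρ 1) h
  · refine symExchanges_sound hm hρ (fun p q r s h => ?_) h
    rw [Bool.or_eq_true] at h
    rcases h with h | h
    · exact symGood_sound hm hρ 0 _ _ _ _ h
    · exact symExchanges_sound hm hρ (symGood_sound hm hρ 0) h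

theorem symPair_sound (hm : 6 ≤ m) (hρ : Realizes ρ) {t x y : Vr ℕ}
    (h : symPair t x y = true) {z w : Vr (ZMod m)} (hxy : compl (x.map ρ) (y.map ρ) = none)
    (hx : x.map ρ ≠ t.map ρ) (hy : y.map ρ ≠ t.map ρ) (hz : compl z w = some (t.map ρ)) :
    quad k (x.map ρ) (y.map ρ) z w ∈ reach k m := by
  have key : ∀ n, anyRep t (symGood n x y) = true →
      quad k (x.map ρ) (y.map ρ) z w ∈ reach k m := by
    intro n h
    obtain ⟨p, q, hpq, h⟩ := anyRep_sound h
    exact mem_reach_of_sub (quad_sub_mem_sqAnn hm hxy (hz.trans (symCompl_sound hm hρ hpq).symm))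
      (symGood_sound hm hρ n _ _ _ _ h)
  simp only [symPair, Bool.or_eq_true, decide_eq_true_eq] at h
  rcases h with ((((rfl | rfl) | h) | h) | h) | h
  · exact absurd rfl hx
  · exact absurd rfl hy
  · obtain ⟨u, hu⟩ := Option.isSome_iff_exists.1 h
    rw [symCompl_sound hm hρ hu] at hxy
    cases hxy
  · exact key 0 h
  · exact key 1 h
  · exact key 2 h

end

/-! ### Realizing arbitrary variables by symbols. -/

/-- The interpretation of the symbolic indices with three given centres. -/
def place (i j l : ZMod m) (p : ℕ) : ZMod m :=
  if p < 10 then i + p - 5 else if p < 20 then j + p - 15 else l + p - 25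

/-- `j` is at distance at least `3` from `i`. -/
def Far (i j : ZMod m) : Prop := ∀ n : ℕ, n ≤ 4 → j ≠ i + n - 2

theorem realizes_place (hm : 6 ≤ m) {i j l : ZMod m} (hj : Far i j) (hl : Far i l) :
    Realizes (place i j l) := by
  have hnz : ∀ n : ℕ, 0 < n → n < 6 → (n : ZMod m) ≠ 0 := fun n h h' =>
    natCast_ne_zero h (by omega)
  have near : ∀ p q : ℕ, p + 2 ≤ q → q ≤ p + 4 → ∀ i : ZMod m,
      (i + p - 5 ≠ i + q - 5 ∧ i + q - 5 ≠ i + p - 5 + 1 ∧ i + p - 5 ≠ i + q - 5 + 1) := by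
    intro p q h1 h2 i
    obtain ⟨n, rfl⟩ := Nat.exists_eq_add_of_le h1
    refine ⟨fun h => hnz (n + 2) (by omega) (by omega) ?_,
      fun h => hnz (n + 1) (by omega) (by omega) ?_,
      fun h => hnz (n + 3) (by omega) (by omega) ?_⟩
    · push_cast at h ⊢; linear_combination -h
    · push_cast at h ⊢; linear_combination h
    · push_cast at h ⊢; linear_combination -h
  -- A far index is at distance at least 3 from the centre, hence at least 2 from the positions next
  -- to it.
  have far : ∀ p : ℕ, 4 ≤ p → p ≤ 6 → ∀ j : ZMod m, Far i j →
      (i + p - 5 ≠ j ∧ j ≠ i + p - 5 + 1 ∧ i + p - 5 ≠ j + 1) := by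
    intro p h1 h2 j hj
    obtain ⟨n, rfl⟩ := Nat.exists_eq_add_of_le h1
    refine ⟨fun h => hj (n + 1) (by omega) ?_, fun h => hj (n + 2) (by omega) ?_,
      fun h => hj n (by omega) ?_⟩
    · push_cast at h ⊢; linear_combination -h
    · push_cast at h ⊢; linear_combination h
    · push_cast at h ⊢; linear_combination -h
  have fars : ∀ p q : ℕ, 4 ≤ p → p ≤ 6 → (q = 15 ∨ q = 25) →
      place i j l p ≠ place i j l q ∧ place i j l q ≠ place i j l p + 1 ∧
        place i j l p ≠ place i j l q + 1 := by
    intro p q h1 h2 hq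
    have hp : place i j l p = i + p - 5 := if_pos (by omega)
    rcases hq with rfl | rfl
    · have : place i j l 15 = j := by simp [place]
      rw [this, hp]
      exact far p h1 h2 j hj
    · have : place i j l 25 = l := by simp [place]
      rw [this, hp]
      exact far p h1 h2 l hl
  constructor
  · intro p hp
    simp only [place]
    split_ifs <;> first | omega | (push_cast; ring)
  · intro p q h
    simp only [apart] at h
    split_ifs at h with hp hq
    · simp only [Bool.or_eq_true, Bool.and_eq_true, decide_eq_true_eq] at h
      simp only [place, if_pos hp, if_pos hq]
      rcases h with h | h
      · exact near p q h.1 h.2 i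
      · obtain ⟨h1, h2, h3⟩ := near q p h.1 h.2 i
        exact ⟨h1.symm, h3, h2⟩
    · simp only [Bool.or_eq_true, Bool.and_eq_true, decide_eq_true_eq, beq_iff_eq] at h
      exact fars p q (by omega) (by omega) (by omega)
    · simp only [Bool.or_eq_true, Bool.and_eq_true, decide_eq_true_eq, beq_iff_eq] at h
      obtain ⟨h1, h2, h3⟩ := fars q p (by omega) (by omega) (by omega)
      exact ⟨h1.symm, h3, h2⟩

/-- The offset 3 differs from the offsets `-2, …, 2` by `1, …, 5`, all nonzero modulo `m`. -/
theorem exists_far (hm : 6 ≤ m) (i : ZMod m) : Far i (i + 3) := by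
  intro n hn h
  refine natCast_ne_zero (m := m) (n := 5 - n) (by omega) (by omega) ?_
  rw [Nat.cast_sub (by omega)]
  push_cast
  linear_combination h

theorem exists_position (i j : ZMod m) : Far i j ∨ ∃ p ∈ [3, 4, 5, 6, 7], ∀ l l',
    place i l l' p = j := by
  by_cases h : Far i j
  · exact Or.inl h
  · right
    simp only [Far, not_forall, not_not] at h
    obtain ⟨n, hn, rfl⟩ := h
    refine ⟨n + 3, ?_, fun l l' => ?_⟩
    · interval_cases n <;> simp
    · rw [place, if_pos (by omega)]
      push_cast
      ring

/-- If `x` needs no far position, the first far centre is a dummy, `i + 3`. The second centre stays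
free, so that a second variable can be symbolized independently. -/
theorem exists_symbol_fst (hm : 6 ≤ m) (i : ZMod m) (x : Vr (ZMod m)) :
    ∃ j, Far i j ∧ ∃ x' ∈ window [3, 4, 5, 6, 7, 15], ∀ l, x'.map (place i j l) = x := by
  have key : ∀ (f : ∀ {A : Type}, A → Vr A) (hf : ∀ p ∈ [3, 4, 5, 6, 7, 15],
      f p ∈ window [3, 4, 5, 6, 7, 15]) (hmap : ∀ (ρ : ℕ → ZMod m) p, (f p).map ρ = f (ρ p))
      (j : ZMod m), ∃ l, Far i l ∧ ∃ x' ∈ window [3, 4, 5, 6, 7, 15],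
        ∀ l', x'.map (place i l l') = f j := by
    intro f hf hmap j
    rcases exists_position i j with h | ⟨p, hp, h⟩
    · exact ⟨j, h, f 15, hf _ (by simp), fun l' => by rw [hmap]; simp [place]⟩
    · exact ⟨i + 3, exists_far hm i, f p, hf _ (by simp at hp ⊢; tauto), fun l' => by
        rw [hmap, h]⟩
  cases x with
  | d => exact ⟨i + 3, exists_far hm i, .d, by simp [window], fun l => rfl⟩
  | e => exact ⟨i + 3, exists_far hm i, .e, by simp [window], fun l => rfl⟩
  | a j => exact key .a (by decide) (fun _ _ => rfl) j
  | b j => exact key .b (by decide) (fun _ _ => rfl) j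
  | c j => exact key .c (by decide) (fun _ _ => rfl) j

theorem exists_symbol_snd (hm : 6 ≤ m) (i : ZMod m) (x : Vr (ZMod m)) :
    ∃ j, Far i j ∧ ∃ x' ∈ window [3, 4, 5, 6, 7, 25], ∀ l, x'.map (place i l j) = x := by
  have key : ∀ (f : ∀ {A : Type}, A → Vr A) (hf : ∀ p ∈ [3, 4, 5, 6, 7, 25],
      f p ∈ window [3, 4, 5, 6, 7, 25]) (hmap : ∀ (ρ : ℕ → ZMod m) p, (f p).map ρ = f (ρ p))
      (j : ZMod m), ∃ l, Far i l ∧ ∃ x' ∈ window [3, 4, 5, 6, 7, 25],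
        ∀ l', x'.map (place i l' l) = f j := by
    intro f hf hmap j
    rcases exists_position i j with h | ⟨p, hp, h⟩
    · exact ⟨j, h, f 25, hf _ (by simp), fun l' => by rw [hmap]; simp [place]⟩
    · exact ⟨i + 3, exists_far hm i, f p, hf _ (by simp at hp ⊢; tauto), fun l' => by
        rw [hmap, h]⟩
  cases x with
  | d => exact ⟨i + 3, exists_far hm i, .d, by simp [window], fun l => rfl⟩
  | e => exact ⟨i + 3, exists_far hm i, .e, by simp [window], fun l => rfl⟩
  | a j => exact key .a (by decide) (fun _ _ => rfl) j
  | b j => exact key .b (by decide) (fun _ _ => rfl) j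
  | c j => exact key .c (by decide) (fun _ _ => rfl) j

noncomputable section

variable {k : Type*} [Field k] {m : ℕ}

theorem realizes_default (hm : 6 ≤ m) (i : ZMod m) :
    Realizes (place i (i + 3) (i + 3)) :=
  realizes_place hm (exists_far hm i) (exists_far hm i)

theorem place_five (i j l : ZMod m) : place i j l 5 = i := by simp [place]

theorem vr_cases (x : Vr (ZMod m)) : (x = .d ∨ x = .e) ∨
    ∃ i, ∃ x' ∈ [Vr.a 5, Vr.b 5, Vr.c 5], ∀ j l, x'.map (place i j l) = x := by
  cases x with
  | d => simp
  | e => simp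
  | a i => exact Or.inr ⟨i, .a 5, by simp, fun j l => by simp [Vr.map, place_five]⟩
  | b i => exact Or.inr ⟨i, .b 5, by simp, fun j l => by simp [Vr.map, place_five]⟩
  | c i => exact Or.inr ⟨i, .c 5, by simp, fun j l => by simp [Vr.map, place_five]⟩

theorem exists_near_symbol {i j l : ZMod m} {x' : Vr ℕ} (hx' : x' ∈ [Vr.a 5, Vr.b 5, Vr.c 5])
    {y : Vr (ZMod m)} (h : compl (x'.map (place i j l)) y ≠ none) :
    ∃ y' ∈ window [4, 5, 6], y'.map (place i j l) = y := by
  have h4 : place i j l 4 = i - 1 := by simp [place]; ring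
  have h5 : place i j l 5 = i := place_five i j l
  have h6 : place i j l 6 = i + 1 := by simp [place]; ring
  have key : ∀ (f : ∀ {A : Type}, A → Vr A) (hf : ∀ p ∈ [4, 5, 6], f p ∈ window [4, 5, 6])
      (hmap : ∀ (ρ : ℕ → ZMod m) p, (f p).map ρ = f (ρ p)) (n : ZMod m),
      (n = i ∨ n = i + 1 ∨ i = n + 1) → ∃ y' ∈ window [4, 5, 6], y'.map (place i j l) = f n := by
    intro f hf hmap n hn
    rcases hn with rfl | rfl | rfl
    · exact ⟨f 5, hf _ (by simp), by rw [hmap, h5]⟩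
    · exact ⟨f 6, hf _ (by simp), by rw [hmap, h6]⟩
    · exact ⟨f 4, hf _ (by simp), by rw [hmap, h4]; congr 1; ring⟩
  have near : ∀ n : ZMod m, y = .a n ∨ y = .b n ∨ y = .c n → n = i ∨ n = i + 1 ∨ i = n + 1 := by
    intro n hn
    by_contra! hcon
    obtain ⟨e1, e2, e3⟩ := hcon
    apply h
    simp only [List.mem_cons, List.not_mem_nil, or_false] at hx'
    rcases hx' with rfl | rfl | rfl <;> rcases hn with rfl | rfl | rfl <;>
      simp [Vr.map, h5, compl, e1, e1.symm, e2, e3]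
  cases y with
  | d => exact ⟨.d, by simp [window], rfl⟩
  | e => exact ⟨.e, by simp [window], rfl⟩
  | a n => exact key .a (by decide) (fun _ _ => rfl) n (near n (by simp))
  | b n => exact key .b (by decide) (fun _ _ => rfl) n (near n (by simp))
  | c n => exact key .c (by decide) (fun _ _ => rfl) n (near n (by simp))

/-- The functionals `ψ` descend to the quotient and separate the classes of the `w j`, so a spanning
family with a dual family is a basis. All nonzero Hilbert function values are obtained this way. -/
theorem hilbertFunction_eq {σ ι : Type*} [Fintype ι] [DecidableEq ι]
    {J : Ideal (MvPolynomial σ k)} {n : ℕ} (w : ι → MvPolynomial σ k)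
    (ψ : ι → MvPolynomial σ k →ₗ[k] k) (hw : ∀ j, (w j).IsHomogeneous n)
    (hψ : ∀ j, ∀ s ∈ J, ψ j s = 0) (hd : ∀ i j, ψ i (w j) = if i = j then 1 else 0)
    (hs : homogeneousSubmodule σ k n ≤ J.restrictScalars k ⊔ Submodule.span k (Set.range w)) :
    hilbertFunction J n = Nat.card ι := by
  set q := (Ideal.Quotient.mkₐ k J).toLinearMap with hq
  have hq0 : ∀ s, q s = 0 ↔ s ∈ J := fun s => Ideal.Quotient.eq_zero_iff_mem
  have e : (homogeneousSubmodule σ k n).map q = Submodule.span k (Set.range (q ∘ w)) := by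
    apply le_antisymm
    · refine (Submodule.map_mono hs).trans ?_
      rw [Submodule.map_sup, Submodule.map_span, ← Set.range_comp]
      refine sup_le ?_ le_rfl
      rintro _ ⟨s, hs, rfl⟩
      rw [(hq0 s).2 hs]
      exact zero_mem _
    · rw [Submodule.span_le]
      rintro _ ⟨j, rfl⟩
      exact ⟨w j, hw j, rfl⟩
  have hli : LinearIndependent k (q ∘ w) := by
    rw [Fintype.linearIndependent_iff]
    intro g hg i
    have h0 : ∑ j, g j • w j ∈ J := by
      rw [← hq0, map_sum]
      simpa using hg
    have h1 := hψ i _ h0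
    simpa [map_sum, hd] using h1
  rw [hilbertFunction, ← hq, e, finrank_span_eq_card hli, Nat.card_eq_fintype_card]

theorem homogeneousSubmodule_le {σ : Type*} {n : ℕ} {W : Submodule k (MvPolynomial σ k)}
    (h : ∀ u : σ →₀ ℕ, u.degree = n → monomial u 1 ∈ W) : homogeneousSubmodule σ k n ≤ W := by
  intro p hp
  rw [p.as_sum]
  refine Submodule.sum_mem _ fun u hu => ?_
  have : (monomial u (coeff u p) : MvPolynomial σ k) = coeff u p • monomial u 1 := by
    simp [smul_monomial]
  rw [this]
  refine Submodule.smul_mem _ _ (h u ?_)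
  by_contra hne
  exact (mem_support_iff.1 hu) (((mem_homogeneousSubmodule n p).1 hp).coeff_eq_zero hne)

theorem homogeneousSubmodule_succ_le {n : ℕ} {W : Submodule k (MvPolynomial (Var m) k)}
    (h : ∀ x, ∀ s ∈ homogeneousSubmodule (Var m) k n, vr k x * s ∈ W) :
    homogeneousSubmodule (Var m) k (n + 1) ≤ W := by
  refine homogeneousSubmodule_le fun u hu => ?_
  have hne : u ≠ 0 := by
    rintro rfl
    simp at hu
  obtain ⟨v, hv⟩ := Finsupp.ne_iff.1 hne
  have e : Finsupp.single v 1 + (u - Finsupp.single v 1) = u :=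
    add_tsub_cancel_of_le (by
      rw [Finsupp.single_le_iff]
      exact Nat.one_le_iff_ne_zero.2 hv)
  have hdeg : (u - Finsupp.single v 1).degree = n := by
    have := congrArg Finsupp.degree e
    rw [map_add, Finsupp.degree_single] at this
    omega
  have := h ((equivVar m).symm v) (monomial (u - Finsupp.single v 1) 1)
    (isHomogeneous_monomial 1 hdeg)
  rwa [vr, Equiv.apply_symm_apply, X, monomial_mul, e, one_mul] at this

/-! ### Every quartic monomial is reachable. -/

variable [NeZero m]

theorem quad_self_mem_reach (hm : 6 ≤ m) {x z w : Vr (ZMod m)} (h : compl x x = none)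
    (h' : compl z w = some x) : quad k x x z w ∈ reach k m := by
  obtain ⟨ρ, hρ⟩ : ∃ ρ : ℕ → ZMod m, Realizes ρ := ⟨_, realizes_default hm 0⟩
  rcases eq_d_or_eq_e hm h with rfl | rfl
  · have h1 := symCompl_sound hm hρ (show symCompl (.a 5) (.b 6) = some .d by decide)
    have h2 : Reached k ρ .d .d (.a 5) (.b 6) :=
      symExchanges_sound hm hρ (symGood_sound hm hρ 1) symExchanges_de.1
    exact mem_reach_of_sub (quad_sub_mem_sqAnn hm h (h'.trans h1.symm)) h2
  · have h1 := symCompl_sound hm hρ (show symCompl (.b 5) (.c 6) = some .e by decide)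
    have h2 : Reached k ρ .e .e (.b 5) (.c 6) :=
      symExchanges_sound hm hρ (symGood_sound hm hρ 1) symExchanges_de.2
    exact mem_reach_of_sub (quad_sub_mem_sqAnn hm h (h'.trans h1.symm)) h2

/-- The window is centred at the index of `t`. If `t` is `d` or `e`, it is centred at `x` or `y`
instead, unless these have no index either. -/
theorem quad_mem_reach_of_ne (hm : 6 ≤ m) {x y z w t : Vr (ZMod m)} (h : compl x y = none)
    (h' : compl z w = some t) (hx : x ≠ t) (hy : y ≠ t) : quad k x y z w ∈ reach k m := by
  rcases vr_cases t with ht | ⟨i, t', ht', ht⟩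
  · obtain ⟨t', ht', ht⟩ : ∃ t' ∈ [Vr.d, Vr.e], ∀ ρ : ℕ → ZMod m, t'.map ρ = t := by
      rcases ht with rfl | rfl
      · exact ⟨.d, by simp, fun _ => rfl⟩
      · exact ⟨.e, by simp, fun _ => rfl⟩
    have anchored : ∀ x y : Vr (ZMod m), compl x y = none → x ≠ t → y ≠ t →
        (∃ i, ∃ x' ∈ [Vr.a 5, Vr.b 5, Vr.c 5], ∀ j l, x'.map (place i j l) = x) →
        quad k x y z w ∈ reach k m := by
      rintro x y h hx hy ⟨i, x', hx', hxx⟩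
      obtain ⟨j, hj, y', hy', hyy⟩ := exists_symbol_fst hm i y
      have hρ := realizes_place hm hj hj
      rw [← hxx j j, ← hyy j] at h ⊢
      rw [← hxx j j] at hx
      rw [← hyy j] at hy
      rw [← ht (place i j j)] at hx hy h'
      exact symPair_sound hm hρ (window_symPair_de t' ht' x' hx' y' hy') h hx hy h'
    rcases vr_cases x with hxd | hxi
    · rcases vr_cases y with hyd | hyi
      · have hρ := realizes_default hm (0 : ZMod m)
        have sym : ∀ x : Vr (ZMod m), x = .d ∨ x = .e →
            ∃ x' ∈ [Vr.d, Vr.e], x'.map (place (0 : ZMod m) (0 + 3) (0 + 3)) = x := by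
          rintro x (rfl | rfl)
          · exact ⟨.d, by simp, rfl⟩
          · exact ⟨.e, by simp, rfl⟩
        obtain ⟨x', hx', rfl⟩ := sym x hxd
        obtain ⟨y', hy', rfl⟩ := sym y hyd
        rw [← ht (place 0 (0 + 3) (0 + 3))] at hx hy h'
        exact symPair_sound hm hρ (symPair_de t' ht' x' hx' y' hy') h hx hy h'
      · rw [quad_swap_left]
        exact anchored y x ((compl_comm hm _ _).trans h) hy hx hyi
    · exact anchored x y h hx hy hxi
  · obtain ⟨j, hj, x', hx', hxx⟩ := exists_symbol_fst hm i x
    obtain ⟨l, hl, y', hy', hyy⟩ := exists_symbol_snd hm i y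
    have hρ := realizes_place hm hj hl
    rw [← hxx l, ← hyy j] at h ⊢
    rw [← hxx l] at hx
    rw [← hyy j] at hy
    rw [← ht j l] at hx hy h'
    exact symPair_sound hm hρ (window_symPair t' ht' x' hx' y' hy') h hx hy h'

theorem quad_mem_reach_of_none (hm : 6 ≤ m) (x y z w : Vr (ZMod m)) (h : compl x y = none) :
    quad k x y z w ∈ reach k m := by
  cases h' : compl z w with
  | none => exact mem_reach_of_mem (quad_mem_sqAnn hm h h')
  | some t =>
    by_cases hxy : x = y
    · subst hxy
      by_cases hx : x = t
      · subst hx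
        exact quad_self_mem_reach hm h h'
      · exact quad_mem_reach_of_ne hm h h' hx hx
    · by_cases hx : x = t
      · subst hx
        rw [quad_swap_left]
        exact quad_mem_reach_of_eq hm hxy ((compl_comm hm _ _).trans h) h'
      · by_cases hy : y = t
        · subst hy
          exact quad_mem_reach_of_eq hm (Ne.symm hxy) h h'
        · exact quad_mem_reach_of_ne hm h h' hx hy

/-- Take a factor with an index; if there is none among the first two, they are unrelated. Either it
is unrelated to another factor, or all the others lie in its window. -/
theorem quad_mem_reach (hm : 6 ≤ m) (x y z w : Vr (ZMod m)) : quad k x y z w ∈ reach k m := by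
  have anchored : ∀ x y z w : Vr (ZMod m),
      (∃ i, ∃ x' ∈ [Vr.a 5, Vr.b 5, Vr.c 5], ∀ j l, x'.map (place i j l) = x) →
      quad k x y z w ∈ reach k m := by
    rintro x y z w ⟨i, x', hx', hxx⟩
    by_cases hy : compl x y = none
    · exact quad_mem_reach_of_none hm _ _ _ _ hy
    by_cases hz : compl x z = none
    · rw [quad_swap_mid]
      exact quad_mem_reach_of_none hm _ _ _ _ hz
    by_cases hw : compl x w = none
    · rw [quad_swap_right, quad_swap_mid]
      exact quad_mem_reach_of_none hm _ _ _ _ hw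
    have hρ := realizes_default hm i
    rw [← hxx (i + 3) (i + 3)] at hy hz hw ⊢
    obtain ⟨y', hy', rfl⟩ := exists_near_symbol hx' hy
    obtain ⟨z', hz', rfl⟩ := exists_near_symbol hx' hz
    obtain ⟨w', hw', rfl⟩ := exists_near_symbol hx' hw
    exact symClique_sound hm hρ (window_symClique x' hx' y' hy' z' hz' w' hw')
      (quad_mem_reach_of_none hm)
  rcases vr_cases x with hx | hx
  · rcases vr_cases y with hy | hy
    · refine quad_mem_reach_of_none hm _ _ _ _ ?_
      rcases hx with rfl | rfl <;> rcases hy with rfl | rfl <;> rfl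
    · rw [quad_swap_left]
      exact anchored y x z w hy
  · exact anchored x y z w hx

end

/-! ### Computation of the Hilbert functions. -/

noncomputable section

variable {k : Type*} [Field k] {m : ℕ}

theorem natCard_vr : Nat.card (Vr (ZMod m)) = Nat.card (Var m) := Nat.card_congr (equivVar m)

theorem homogeneousSubmodule_zero_le {W : Submodule k (MvPolynomial (Var m) k)} (h : 1 ∈ W) :
    homogeneousSubmodule (Var m) k 0 ≤ W :=
  homogeneousSubmodule_le fun u hu => by
    obtain rfl := (Finsupp.degree_eq_zero_iff u).1 hu
    exact h

theorem homogeneousSubmodule_one_le {W : Submodule k (MvPolynomial (Var m) k)}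
    (h : ∀ x, vr k x ∈ W) : homogeneousSubmodule (Var m) k 1 ≤ W :=
  homogeneousSubmodule_succ_le fun x =>
    homogeneousSubmodule_zero_le (W := W.comap (LinearMap.mulLeft k (vr k x))) (by simpa using h x)

theorem homogeneousSubmodule_two_le {W : Submodule k (MvPolynomial (Var m) k)}
    (h : ∀ x y, vr k x * vr k y ∈ W) : homogeneousSubmodule (Var m) k 2 ≤ W :=
  homogeneousSubmodule_succ_le fun x =>
    homogeneousSubmodule_one_le (W := W.comap (LinearMap.mulLeft k (vr k x))) (h x)

theorem homogeneousSubmodule_three_le {W : Submodule k (MvPolynomial (Var m) k)}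
    (h : ∀ x y z, vr k x * (vr k y * vr k z) ∈ W) : homogeneousSubmodule (Var m) k 3 ≤ W :=
  homogeneousSubmodule_succ_le fun x =>
    homogeneousSubmodule_two_le (W := W.comap (LinearMap.mulLeft k (vr k x))) (h x)

theorem homogeneousSubmodule_four_le {W : Submodule k (MvPolynomial (Var m) k)}
    (h : ∀ x y z w, quad k x y z w ∈ W) : homogeneousSubmodule (Var m) k 4 ≤ W :=
  homogeneousSubmodule_succ_le fun x =>
    homogeneousSubmodule_three_le (W := W.comap (LinearMap.mulLeft k (vr k x))) fun y z w => by
      simpa only [quad, mul_assoc, Submodule.mem_comap, LinearMap.mulLeft_apply] using h x y z w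

variable (k m) in
/-- A term of the cubic. -/
def cubicTerm : MvPolynomial (Var m) k :=
  vr k (rep (.a 0)).1 * vr k (rep (.a 0)).2 * vr k (.a 0)

theorem cubicTerm_isHomogeneous : (cubicTerm k m).IsHomogeneous 3 :=
  ((vr_isHomogeneous _).mul (vr_isHomogeneous _)).mul (vr_isHomogeneous _)

theorem pderiv_vr (x y : Vr (ZMod m)) :
    pderiv (equivVar m x) (vr k y) = if x = y then 1 else 0 := by
  rw [vr, pderiv_X]
  split_ifs with h
  · subst h
    simp
  · rw [Pi.single_apply, if_neg]
    intro h'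
    exact h ((equivVar m).injective h').symm

theorem hilbertFunction_eq_zero {σ : Type*} {J : Ideal (MvPolynomial σ k)} {n : ℕ}
    (h : homogeneousSubmodule σ k n ≤ J.restrictScalars k) : hilbertFunction J n = 0 := by
  rw [hilbertFunction_eq (ι := Empty) Empty.elim Empty.elim (by simp) (by simp) (by simp)
    (h.trans le_sup_left)]
  simp

variable [NeZero m]

instance : Fintype (Vr (ZMod m)) := Fintype.ofEquiv _ (equivVar m).symm

variable (k) in
/-- The functional `s ↦ φ (s t)`. -/
def phiMul (t : MvPolynomial (Var m) k) : MvPolynomial (Var m) k →ₗ[k] k :=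
  phi k m ∘ₗ LinearMap.mulRight k t

theorem phiMul_apply (s t : MvPolynomial (Var m) k) : phiMul k t s = phi k m (s * t) := rfl

theorem phiMul_eq_zero {s t : MvPolynomial (Var m) k}
    (hs : s ∈ Ann (dualElement (cubicF'' k m))) : phiMul k t s = 0 := mem_Ann_iff.1 hs t

theorem phi_rep_mul (hm : 6 ≤ m) (x y : Vr (ZMod m)) :
    phi k m (vr k (rep x).1 * vr k (rep x).2 * vr k y) = if x = y then 1 else 0 := by
  rw [phi_triple hm, compl_rep hm]
  simp

theorem phi_cubicTerm (hm : 6 ≤ m) : phi k m (cubicTerm k m) = 1 := by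
  simp [cubicTerm, phi_rep_mul hm]

theorem hilbertFunction_zero (hm : 6 ≤ m) :
    hilbertFunction (Ann (dualElement (cubicF'' k m))) 0 = 1 := by
  rw [hilbertFunction_eq (ι := Unit) (fun _ => 1) (fun _ => phiMul k (cubicTerm k m))
    (fun _ => isHomogeneous_one _ _) (fun _ s hs => phiMul_eq_zero hs)
    (fun _ _ => by simp [phiMul_apply, phi_cubicTerm hm])
    (homogeneousSubmodule_zero_le (Submodule.mem_sup_right (Submodule.subset_span ⟨(), rfl⟩)))]
  simp

/-- The pairing `(s, t) ↦ φ (s t)` makes the variables dual to their chosen complementary pairs; the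
same pairing serves in degree 2. -/
theorem hilbertFunction_one (hm : 6 ≤ m) :
    hilbertFunction (Ann (dualElement (cubicF'' k m))) 1 = Nat.card (Var m) := by
  rw [← natCard_vr]
  refine hilbertFunction_eq (vr k) (fun x => phiMul k (vr k (rep x).1 * vr k (rep x).2))
    vr_isHomogeneous (fun _ s hs => phiMul_eq_zero hs)
    (fun x y => ?_)
    (homogeneousSubmodule_one_le fun x =>
      Submodule.mem_sup_right (Submodule.subset_span ⟨x, rfl⟩))
  rw [phiMul_apply, mul_comm, phi_rep_mul hm]

theorem hilbertFunction_two (hm : 6 ≤ m) :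
    hilbertFunction (Ann (dualElement (cubicF'' k m))) 2 = Nat.card (Var m) := by
  rw [← natCard_vr]
  refine hilbertFunction_eq (fun x => vr k (rep x).1 * vr k (rep x).2) (fun x => phiMul k (vr k x))
    (fun x => (vr_isHomogeneous _).mul (vr_isHomogeneous _)) (fun _ s hs => phiMul_eq_zero hs)
    (fun x y => ?_) (homogeneousSubmodule_two_le fun x y => ?_)
  · rw [phiMul_apply, phi_rep_mul hm]
    simp only [eq_comm]
  · cases h : compl x y with
    | none => exact Submodule.mem_sup_left (mul_mem_Ann hm h)
    | some z =>
      rw [← sub_add_cancel (vr k x * vr k y) (vr k (rep z).1 * vr k (rep z).2)]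
      exact add_mem (Submodule.mem_sup_left (sub_mem_Ann hm (h.trans (compl_rep hm z).symm)))
        (Submodule.mem_sup_right (Submodule.subset_span ⟨z, rfl⟩))

theorem hilbertFunction_three (hm : 6 ≤ m) :
    hilbertFunction (Ann (dualElement (cubicF'' k m))) 3 = 1 := by
  rw [hilbertFunction_eq (ι := Unit) (fun _ => cubicTerm k m) (fun _ => phiMul k 1)
    (fun _ => cubicTerm_isHomogeneous) (fun _ s hs => phiMul_eq_zero hs)
    (fun _ _ => by simp [phiMul_apply, phi_cubicTerm hm]) ?_]
  · simp
  · intro s hs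
    have hs' : s.IsHomogeneous 3 := hs
    rw [← sub_add_cancel s (phi k m s • cubicTerm k m)]
    refine add_mem (Submodule.mem_sup_left (mem_Ann_of_three ?_ ?_)) (Submodule.mem_sup_right
      (Submodule.smul_mem _ _ (Submodule.subset_span ⟨(), rfl⟩)))
    · exact hs'.sub (Submodule.smul_mem (homogeneousSubmodule (Var m) k 3) _
        cubicTerm_isHomogeneous)
    · rw [map_sub, map_smul, phi_cubicTerm hm, smul_eq_mul, mul_one, sub_self]

theorem hilbertFunction_four_le {n : ℕ} (hn : 4 ≤ n) :
    hilbertFunction (Ann (dualElement (cubicF'' k m))) n = 0 :=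
  hilbertFunction_eq_zero fun _ hs => mem_Ann_of_four_le hs hn

variable (k) in
/-- The functional `s ↦ φ (∂ s / ∂ x)`. -/
def phiDeriv (x : Vr (ZMod m)) : MvPolynomial (Var m) k →ₗ[k] k :=
  phi k m ∘ₗ (pderiv (equivVar m x)).toLinearMap

theorem phiDeriv_apply (x : Vr (ZMod m)) (s : MvPolynomial (Var m) k) :
    phiDeriv k x s = phi k m (pderiv (equivVar m x) s) := rfl

/-- By the Leibniz rule a derivation maps `I^2` into `I`, on which `φ` vanishes. -/
theorem phiDeriv_eq_zero (x : Vr (ZMod m)) {s : MvPolynomial (Var m) k} (hs : s ∈ sqAnn k m) :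
    phiDeriv k x s = 0 := by
  rw [sqAnn, pow_two] at hs
  refine Submodule.mul_induction_on hs (fun p hp q hq => ?_) fun p q hp hq => ?_
  · rw [phiDeriv_apply, Derivation.leibniz, smul_eq_mul, smul_eq_mul, map_add,
      mem_Ann_iff.1 hp, mem_Ann_iff.1 hq, add_zero]
  · rw [map_add, hp, hq, add_zero]

/-- Differentiating a factor of the term `p q r` leaves `y` times the other two factors, which is
not a term because their complement is not `y`. Only differentiating `y` contributes, with
coefficient 1 in every characteristic. -/
theorem phiDeriv_quad (hm : 6 ≤ m) (x : Vr (ZMod m)) {y p q r : Vr (ZMod m)}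
    (h : compl q r = some p) (hp : p ≠ y) (hq : q ≠ y) (hr : r ≠ y) :
    phiDeriv k x (quad k y p q r) = if x = y then 1 else 0 := by
  have e : pderiv (equivVar m x) (quad k y p q r)
      = (if x = y then 1 else 0 : k) • (vr k q * vr k r * vr k p)
        + (if x = p then 1 else 0 : k) • (vr k q * vr k r * vr k y)
        + (if x = q then 1 else 0 : k) • (vr k r * vr k p * vr k y)
        + (if x = r then 1 else 0 : k) • (vr k p * vr k q * vr k y) := by
    simp only [quad, Derivation.leibniz, pderiv_vr, smul_eq_mul, ite_smul, one_smul, zero_smul]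
    split_ifs <;> ring
  have h1 := compl_rotate hm h
  have h2 := compl_rotate hm h1
  have z : ∀ {u v t : Vr (ZMod m)}, compl u v = some t → t ≠ y →
      phi k m (vr k u * vr k v * vr k y) = 0 := by
    intro u v t h ht
    rw [phi_triple hm, h, if_neg (by simpa using ht)]
  rw [phiDeriv_apply, e]
  simp only [map_add, map_smul, z h hp, z h1 hq, z h2 hr]
  simp [phi_triple hm, h]

/-- A pair complementary to `base y` cannot contain `y`, since `y` and `base y` would then be
related. -/
theorem phiDeriv_eps (hm : 6 ≤ m) (x y : Vr (ZMod m)) :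
    phiDeriv k x (eps k y) = if x = y then 1 else 0 := by
  have hb := compl_base hm y
  have hr := compl_rep hm (base y)
  refine phiDeriv_quad hm x hr (base_ne y) ?_ ?_
  · intro h
    rw [h] at hr
    have := compl_swap hm hr
    rw [this] at hb
    cases hb
  · intro h
    rw [h] at hr
    have := compl_rotate hm hr
    rw [this] at hb
    cases hb

theorem hilbertFunction_sq_four (hm : 6 ≤ m) :
    hilbertFunction (sqAnn k m) 4 = Nat.card (Var m) := by
  rw [← natCard_vr]
  exact hilbertFunction_eq (eps k) (phiDeriv k) (fun x => quad_isHomogeneous _ _ _ _)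
    (fun x s hs => phiDeriv_eq_zero x hs) (phiDeriv_eps hm)
    (homogeneousSubmodule_four_le (quad_mem_reach hm))

theorem hilbertFunction_sq_five (hm : 6 ≤ m) : hilbertFunction (sqAnn k m) 5 = 0 := by
  refine hilbertFunction_eq_zero (homogeneousSubmodule_succ_le fun x s hs => ?_)
  have h1 : s ∈ reach k m := homogeneousSubmodule_four_le (quad_mem_reach hm) hs
  have h2 : reach k m ≤
      ((sqAnn k m).restrictScalars k).comap (LinearMap.mulLeft k (vr k x)) := by
    refine sup_le (fun s hs => Ideal.mul_mem_left _ _ hs) ?_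
    rw [Submodule.span_le]
    rintro _ ⟨y, rfl⟩
    exact vr_mul_eps_mem hm x y
  exact h2 h1

end

end Apolarity

theorem mainTheorem6 (k : Type*) [Field k] (m : ℕ) [NeZero m] (hm : 6 ≤ m) :
    Nat.card (Apolarity.Var m) = 3 * m + 2 ∧
      Apolarity.SmallTangentSpaceCondition
        (Apolarity.dualElement (Apolarity.cubicF'' k m)) :=
  ⟨Apolarity.card_Var m,
    { homogeneous := Apolarity.isHomogeneousOfDegree_cubicF''
      hilbert_zero := Apolarity.hilbertFunction_zero hm
      hilbert_one := Apolarity.hilbertFunction_one hm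
      hilbert_two := Apolarity.hilbertFunction_two hm
      hilbert_three := Apolarity.hilbertFunction_three hm
      hilbert_ge_four := fun _ hi => Apolarity.hilbertFunction_four_le hi
      hilbert_sq_four := Apolarity.hilbertFunction_sq_four hm
      hilbert_sq_five := Apolarity.hilbertFunction_sq_five hm }⟩
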